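/- Let $K_n^3$ be the complete $3$-uniform hypergraph on $n$ vertices. For a hypergraph $H$ (identified with its edge set) and $t\ge 1$, the $t$-tight components of $H$ are the classes of the finest partition of its edge set in which any two edges $e,f$ with $|e\cap f|\ge t$ lie in the same class; and for $s\ge 1$, let $E^{(s)}(H)$ be the family of all $s$-element vertex sets contained in some edge of $H$. For $t\in\{1,2\}$, $s\in\{1,2,3\}$ and $n\ge 3$, let $M(n,2,3,t,s)$ be the minimum, over all (not necessarily proper) colorings of the edges of $K_n^3$ with $2$ colors, of the maximum of $|E^{(s)}(C)|$ over all monochromatic $t$-tight components $C$, that is, over all $t$-tight components $C$ of the hypergraphs formed by the edges of one color. Then for every $n\ge 3$, \[ M(n,2,3,1,1)=M(n,2,3,2,1)=n, \qquad M(n,2,3,1,2)=M(n,2,3,2,2)=\binom n2-\binom{\lfloor n/2\rfloor}{2}. \] Moreover, \[ \lim_{n\to\infty}\binom n3^{-1}M(n,2,3,1,3)=6\sqrt{21}-27\approx 0.495, \] and the limit $\lim_{n\to\infty}\binom n3^{-1}M(n,2,3,2,3)$ exists and satisfies \[ 0.24\le \lim_{n\to\infty}\binom n3^{-1}M(n,2,3,2,3)\le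 \frac38 . \] -/

import Mathlib

/-!
  Hypergraphs on a vertex set `V` are identified with their (finite) edge sets,
  that is, with terms of `Finset (Finset V)`.
-/

namespace TightColoring

open Classical in
/-- The `s`-shadow `E^(s)(H)`: all vertex sets of size `s` that are contained in an edge of `H`. -/
noncomputable def shadow {V : Type*} [Fintype V] (s : ℕ) (H : Finset (Finset V)) :
    Finset (Finset V) :=
  Finset.univ.filter fun S => S.card = s ∧ ∃ e ∈ H, S ⊆ e

open Classical in
/-- Two edges of `H` are `t`-adjacent if they share at least `t` vertices. -/
def TightAdj {V : Type*} (t : ℕ) (H : Finset (Finset V)) (e f : Finset V) : Prop :=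
  e ∈ H ∧ f ∈ H ∧ t ≤ (e ∩ f).card

open Classical in
/-- The `t`-tight component of the edge `e` in `H`: all edges of `H` that can be reached from `e`
through a chain of edges of `H` in which consecutive edges share at least `t` vertices. -/
noncomputable def tightComponent {V : Type*} (t : ℕ) (H : Finset (Finset V)) (e : Finset V) :
    Finset (Finset V) :=
  H.filter fun f => Relation.ReflTransGen (TightAdj t H) e f

open Classical in
/-- The family `TC_t(H)` of all `t`-tight components of `H`. -/
noncomputable def tightComponents {V : Type*} (t : ℕ) (H : Finset (Finset V)) :
    Finset (Finset (Finset V)) :=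
  H.image (tightComponent t H)

/-- `Col_r(K_n^k)`: the (not necessarily proper) colorings, with `r` colors, of the edges of the
complete `k`-uniform hypergraph on the vertex set `Fin n`. -/
abbrev Coloring (n r k : ℕ) : Type :=
  {e : Finset (Fin n) // e.card = k} → Fin r

open Classical in
/-- The hypergraph `H_i` of all edges that have color `i`. -/
noncomputable def colorClass {n r k : ℕ} (c : Coloring n r k) (i : Fin r) :
    Finset (Finset (Fin n)) :=
  Finset.univ.filter fun e => ∃ h : e.card = k, c ⟨e, h⟩ = i

/-- `M(n,r,k,t,s; c)`: the largest size of the `s`-shadow of a monochromatic `t`-tight component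
of the coloring `c`. -/
noncomputable def maxShadow {n r k : ℕ} (t s : ℕ) (c : Coloring n r k) : ℕ :=
  Finset.univ.sup fun i : Fin r =>
    (tightComponents t (colorClass c i)).sup fun C => (shadow s C).card

/-- `M(n,r,k,t,s)`: the minimum of `M(n,r,k,t,s; c)` over all `c` in `Col_r(K_n^k)`. -/
noncomputable def M (n r k t s : ℕ) : ℕ :=
  ⨅ c : Coloring n r k, maxShadow t s c

end TightColoring

/-! Everything at `t = 2` rests on links. The edges at a vertex `v` two-color the pairs of the other
vertices, and a graph or its complement is connected, so in some color the edges at `v` are pairwise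
`2`-connected and cover every vertex (`exists_dominates`). Vertices dominating in the same color
share a component (`Dominates.tightConn`). One vertex settles `s = 1`. For `s = 2`, at least half of
the vertices dominate in one color, and a coloring by intersection with two halves is extremal.

For `t = 1`, `s = 3`: if both colors connect all vertices, one component has half of the edges.
Otherwise the other color is a single component, and the vertex components of the disconnected color
force the bound by their sizes (`le_maxShadow_three_of_disconnected`). Splitting the vertices in
proportion `x` to `1 - x` is optimal when the triples inside the large part are as many as the
crossing ones, `x ^ 3 = 3 * x * (1 - x)`.

For `t = 2`, `s = 3`, the limit exists by blowing up: giving triples with two vertices over `u` a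
dominating color of `u` merges no components (`maxShadow_blowUp_le`). Coloring by parity of the
intersection with a half gives `3 / 8`. For `0.24`, split the vertices by dominating color. The
edges of color `i` outside the dominated component lie in the other class, which suffices if both
classes are large. If one is small, its color consists mostly of edges not known to be in one
component; these are bounded by Kruskal–Katona, since distinct components have disjoint `2`-shadows
(`le_maxShadow_of_unbalanced`). -/

namespace TightColoring

/-! ### Tight connectivity and shadows -/

section Hypergraph

variable {V : Type*} {s t : ℕ} {H : Finset (Finset V)} {e f g : Finset V}

/-- Two edges are `t`-connected in `H` if they are joined by a chain of `t`-adjacent edges. -/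
abbrev TightConn (t : ℕ) (H : Finset (Finset V)) : Finset V → Finset V → Prop :=
  Relation.ReflTransGen (TightAdj t H)

theorem tightAdj_iff :
    TightAdj t H e f ↔ e ∈ H ∧ f ∈ H ∧ ∃ S, S ⊆ e ∧ S ⊆ f ∧ t ≤ S.card := by
  classical
  unfold TightAdj
  refine and_congr_right fun _ => and_congr_right fun _ => ⟨fun h => ⟨_, ?_, ?_, h⟩, ?_⟩
  · exact Finset.inter_subset_left
  · exact Finset.inter_subset_right
  · rintro ⟨S, h1, h2, h3⟩
    exact h3.trans (Finset.card_le_card (Finset.subset_inter h1 h2))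

theorem TightAdj.symm (h : TightAdj t H e f) : TightAdj t H f e := by
  rw [tightAdj_iff] at h ⊢
  obtain ⟨h1, h2, S, h3, h4, h5⟩ := h
  exact ⟨h2, h1, S, h4, h3, h5⟩

theorem TightConn.symm (h : TightConn t H e f) : TightConn t H f e := by
  induction h with
  | refl => exact Relation.ReflTransGen.refl
  | tail _ h2 ih => exact Relation.ReflTransGen.head h2.symm ih

theorem tightConn_of_mem_one {x : V} (he : e ∈ H) (hf : f ∈ H) (hx : x ∈ e) (hx' : x ∈ f) :
    TightConn 1 H e f :=
  Relation.ReflTransGen.single (tightAdj_iff.2 ⟨he, hf, {x}, by simpa, by simpa, by simp⟩)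

theorem tightConn_of_mem_two {x y : V} (hxy : x ≠ y) (he : e ∈ H) (hf : f ∈ H)
    (hx : x ∈ e) (hy : y ∈ e) (hx' : x ∈ f) (hy' : y ∈ f) : TightConn 2 H e f := by
  classical
  refine Relation.ReflTransGen.single (tightAdj_iff.2 ⟨he, hf, {x, y}, ?_, ?_, ?_⟩)
  · simp [Finset.insert_subset_iff, hx, hy]
  · simp [Finset.insert_subset_iff, hx', hy']
  · rw [Finset.card_pair hxy]

theorem TightConn.mono {t' : ℕ} (htt : t' ≤ t) (h : TightConn t H e f) : TightConn t' H e f := by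
  induction h with
  | refl => exact Relation.ReflTransGen.refl
  | tail _ h2 ih => exact ih.tail ⟨h2.1, h2.2.1, htt.trans h2.2.2⟩

theorem mem_tightComponent :
    f ∈ tightComponent t H e ↔ f ∈ H ∧ TightConn t H e f := by
  classical
  simp [tightComponent]

theorem mem_tightComponents {C : Finset (Finset V)} :
    C ∈ tightComponents t H ↔ ∃ e ∈ H, tightComponent t H e = C := by
  classical
  simp [tightComponents]

/-- Any property preserved by adjacency spreads along chains; all upper bounds on components use
this with a suitable invariant. -/
theorem tightComponent_subset_of_closed {X : Finset V → Prop} (he : X e)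
    (hX : ∀ f g, X f → TightAdj t H f g → X g) : ∀ f ∈ tightComponent t H e, X f := by
  intro f hf
  have h := (mem_tightComponent.1 hf).2
  clear hf
  induction h with
  | refl => exact he
  | tail _ h2 ih => exact hX _ _ ih h2

theorem mem_shadow [Fintype V] {S : Finset V} :
    S ∈ shadow s H ↔ S.card = s ∧ ∃ e ∈ H, S ⊆ e := by
  classical
  simp [shadow]

theorem shadow_mono [Fintype V] {H' : Finset (Finset V)} (h : H ⊆ H') :
    shadow s H ⊆ shadow s H' := by
  intro S hS
  rw [mem_shadow] at hS ⊢
  obtain ⟨h1, e, he, h2⟩ := hS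
  exact ⟨h1, e, h he, h2⟩

theorem shadow_eq_self [Fintype V] (h : ∀ e ∈ H, e.card = s) : shadow s H = H := by
  ext S
  rw [mem_shadow]
  constructor
  · rintro ⟨h1, e, he, h2⟩
    rwa [Finset.eq_of_subset_of_card_le h2 (by rw [h e he, h1])]
  · exact fun hS => ⟨h S hS, S, hS, subset_rfl⟩

end Hypergraph

/-! ### Color classes and the extremal function -/

section Coloring

variable {n r k s t : ℕ}

theorem mem_colorClass {c : Coloring n r k} {i : Fin r} {e : Finset (Fin n)} :
    e ∈ colorClass c i ↔ ∃ h : e.card = k, c ⟨e, h⟩ = i := by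
  classical
  simp [colorClass]

theorem card_of_mem_colorClass {c : Coloring n r k} {i : Fin r} {e : Finset (Fin n)}
    (h : e ∈ colorClass c i) : e.card = k :=
  (mem_colorClass.1 h).1

theorem exists_mem_colorClass (c : Coloring n r k) {e : Finset (Fin n)} (h : e.card = k) :
    ∃ i, e ∈ colorClass c i :=
  ⟨c ⟨e, h⟩, mem_colorClass.2 ⟨h, rfl⟩⟩

theorem eq_of_mem_colorClass {c : Coloring n r k} {i j : Fin r} {e : Finset (Fin n)}
    (hi : e ∈ colorClass c i) (hj : e ∈ colorClass c j) : i = j := by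
  obtain ⟨h, rfl⟩ := mem_colorClass.1 hi
  obtain ⟨_, rfl⟩ := mem_colorClass.1 hj
  rfl

theorem mem_colorClass_or {c : Coloring n 2 k} {i j : Fin 2} (hij : i ≠ j) {e : Finset (Fin n)}
    (h : e.card = k) : e ∈ colorClass c i ∨ e ∈ colorClass c j := by
  obtain ⟨l, hl⟩ := exists_mem_colorClass c h
  have : l = i ∨ l = j := by omega
  rcases this with rfl | rfl
  · exact Or.inl hl
  · exact Or.inr hl

theorem card_colorClass_add (c : Coloring n 2 k) {i j : Fin 2} (hij : i ≠ j) :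
    (colorClass c i).card + (colorClass c j).card = n.choose k := by
  classical
  rw [← Finset.card_union_of_disjoint]
  · have : colorClass c i ∪ colorClass c j = Finset.powersetCard k Finset.univ := by
      ext e
      simp only [Finset.mem_union, Finset.mem_powersetCard, Finset.subset_univ, true_and]
      exact ⟨fun h => h.elim card_of_mem_colorClass card_of_mem_colorClass,
        mem_colorClass_or hij⟩
    rw [this, Finset.card_powersetCard, Finset.card_univ, Fintype.card_fin]
  · exact Finset.disjoint_left.2 fun e h1 h2 => hij (eq_of_mem_colorClass h1 h2)

theorem card_shadow_tightComponent_le (c : Coloring n r k) {i : Fin r} {e : Finset (Fin n)}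
    (he : e ∈ colorClass c i) :
    (shadow s (tightComponent t (colorClass c i) e)).card ≤ maxShadow t s c := by
  unfold maxShadow
  refine le_trans ?_ (Finset.le_sup (f := fun i : Fin r =>
    (tightComponents t (colorClass c i)).sup fun C => (shadow s C).card) (Finset.mem_univ i))
  refine Finset.le_sup (f := fun C => (shadow s C).card) ?_
  exact mem_tightComponents.2 ⟨e, he, rfl⟩

theorem maxShadow_le {c : Coloring n r k} {K : ℕ}
    (h : ∀ i, ∀ e ∈ colorClass c i,
      (shadow s (tightComponent t (colorClass c i) e)).card ≤ K) : maxShadow t s c ≤ K := by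
  unfold maxShadow
  refine Finset.sup_le fun i _ => Finset.sup_le fun C hC => ?_
  obtain ⟨e, he, rfl⟩ := mem_tightComponents.1 hC
  exact h i e he

theorem maxShadow_anti (c : Coloring n r k) {t' : ℕ} (h : t' ≤ t) :
    maxShadow t s c ≤ maxShadow t' s c := by
  refine maxShadow_le fun i e he => le_trans (Finset.card_le_card (shadow_mono ?_))
    (card_shadow_tightComponent_le c he)
  intro f hf
  rw [mem_tightComponent] at hf ⊢
  exact ⟨hf.1, hf.2.mono h⟩

/-- Lower bounds for `s = k` come from this: a pairwise connected family lies in one component,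
which is its own `k`-shadow. -/
theorem card_le_maxShadow (c : Coloring n r k) {i : Fin r} {X : Finset (Finset (Fin n))}
    (hX : X ⊆ colorClass c i)
    (h : ∀ e ∈ X, ∀ f ∈ X, TightConn t (colorClass c i) e f) : X.card ≤ maxShadow t k c := by
  rcases X.eq_empty_or_nonempty with rfl | ⟨e, he⟩
  · simp
  refine le_trans (Finset.card_le_card ?_) (card_shadow_tightComponent_le c (hX he))
  rw [shadow_eq_self fun f hf => card_of_mem_colorClass (mem_tightComponent.1 hf).1]
  exact fun f hf => mem_tightComponent.2 ⟨hX hf, h e he f hf⟩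

theorem maxShadow_self_le {c : Coloring n r k} {K : ℕ}
    (h : ∀ i, ∀ e ∈ colorClass c i, (tightComponent t (colorClass c i) e).card ≤ K) :
    maxShadow t k c ≤ K := by
  refine maxShadow_le fun i e he => ?_
  rw [shadow_eq_self fun f hf => card_of_mem_colorClass (mem_tightComponent.1 hf).1]
  exact h i e he

theorem card_tightComponent_le (c : Coloring n r k) {i : Fin r} {e : Finset (Fin n)}
    (he : e ∈ colorClass c i) :
    (tightComponent t (colorClass c i) e).card ≤ maxShadow t k c := by
  have := card_shadow_tightComponent_le (s := k) (t := t) c he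
  rwa [shadow_eq_self fun f hf => card_of_mem_colorClass (mem_tightComponent.1 hf).1] at this

theorem M_le (c : Coloring n r k) : M n r k t s ≤ maxShadow t s c :=
  ciInf_le (OrderBot.bddBelow _) c

theorem le_M {K : ℕ} (h : ∀ c : Coloring n 2 k, K ≤ maxShadow t s c) : K ≤ M n 2 k t s :=
  le_ciInf h

theorem exists_maxShadow_eq (n k t s : ℕ) :
    ∃ c : Coloring n 2 k, maxShadow t s c = M n 2 k t s :=
  Nat.sInf_mem (Set.range_nonempty _)

theorem M_anti {t' : ℕ} (h : t' ≤ t) : M n 2 k t s ≤ M n 2 k t' s :=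
  le_M fun c => (M_le c).trans (maxShadow_anti c h)

open Classical in
/-- The coloring that gives color `0` to the edges satisfying `P` and color `1` to the others. -/
noncomputable def coloringOf (k : ℕ) (P : Finset (Fin n) → Prop) : Coloring n 2 k :=
  fun e => if P e.1 then 0 else 1

theorem mem_colorClass_zero {P : Finset (Fin n) → Prop} {e : Finset (Fin n)} :
    e ∈ colorClass (coloringOf k P) 0 ↔ e.card = k ∧ P e := by
  rw [mem_colorClass]
  by_cases h : P e <;> simp [coloringOf, h]

theorem mem_colorClass_one {P : Finset (Fin n) → Prop} {e : Finset (Fin n)} :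
    e ∈ colorClass (coloringOf k P) 1 ↔ e.card = k ∧ ¬ P e := by
  rw [mem_colorClass]
  by_cases h : P e <;> simp [coloringOf, h]

theorem card_filter_inter_le (A : Finset (Fin n)) (j k : ℕ) :
    ((Finset.univ : Finset (Finset (Fin n))).filter
      fun e => e.card = k ∧ (e ∩ A).card = j).card ≤
      A.card.choose j * (n - A.card).choose (k - j) := by
  have : (n - A.card) = Aᶜ.card := by simp [Finset.card_compl]
  rw [this, ← Finset.card_powersetCard, ← Finset.card_powersetCard, ← Finset.card_product]
  refine Finset.card_le_card_of_injOn (fun e => (e ∩ A, e ∩ Aᶜ)) ?_ ?_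
  · intro e he
    simp only [Finset.coe_filter, Finset.mem_univ, true_and, Set.mem_ofPred_eq] at he
    have h1 : (e ∩ A).card + (e ∩ Aᶜ).card = e.card := by
      rw [← Finset.sdiff_eq_inter_compl, Finset.card_inter_add_card_sdiff]
    simp only [Finset.coe_product, Set.mem_prod, Finset.mem_coe, Finset.mem_powersetCard]
    exact ⟨⟨Finset.inter_subset_right, he.2⟩, Finset.inter_subset_right, by omega⟩
  · intro e _ f _ h
    simp only [Prod.mk.injEq] at h
    rw [← Finset.inter_univ e, ← Finset.inter_univ f, ← Finset.union_compl A,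
      Finset.inter_union_distrib_left, Finset.inter_union_distrib_left, h.1, h.2]

end Coloring

/-! ### Dominating colors from connected links -/

section Dominance

variable {n : ℕ}

/-- The vertex `v` dominates in color `i` if the edges of color `i` at `v` are pairwise
`2`-connected and cover all vertices. -/
def Dominates (c : Coloring n 2 3) (i : Fin 2) (v : Fin n) : Prop :=
  (∀ e ∈ colorClass c i, ∀ f ∈ colorClass c i, v ∈ e → v ∈ f →
    TightConn 2 (colorClass c i) e f) ∧
  ∀ x, x ≠ v → ∃ e ∈ colorClass c i, v ∈ e ∧ x ∈ e

/-- A walk in the link of `v` lifts to a chain of edges through `v`, consecutive ones sharing `v`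
and a vertex of the walk. Covering holds because a connected graph on at least two vertices has no
isolated vertex. -/
theorem dominates_of_connected {c : Coloring n 2 3} {i : Fin 2} {v : Fin n} (hn : 3 ≤ n)
    {G : SimpleGraph {x // x ≠ v}} (hG : G.Connected)
    (h : ∀ x y, x ≠ y → (G.Adj x y ↔ ({v, x.1, y.1} : Finset (Fin n)) ∈ colorClass c i)) :
    Dominates c i v := by
  have key : ∀ x z, G.Reachable x z → ∀ e ∈ colorClass c i, ∀ f ∈ colorClass c i,
      v ∈ e → x.1 ∈ e → v ∈ f → z.1 ∈ f → TightConn 2 (colorClass c i) e f := by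
    rintro x z ⟨p⟩
    induction p with
    | @nil x =>
      intro e he f hf h1 h2 h3 h4
      exact tightConn_of_mem_two x.2.symm he hf h1 h2 h3 h4
    | @cons x y z hxy _ ih =>
      intro e he f hf h1 h2 h3 h4
      have hxy' := (h x y hxy.ne).1 hxy
      exact (tightConn_of_mem_two x.2.symm he hxy' h1 h2 (by simp) (by simp)).trans
        (ih _ hxy' f hf (by simp) (by simp) h3 h4)
  constructor
  · intro e he f hf hve hvf
    have aux : ∀ e ∈ colorClass c i, ∃ x, x ≠ v ∧ x ∈ e := fun e he => by
      have := card_of_mem_colorClass he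
      obtain ⟨x, hx, hxv⟩ := Finset.exists_mem_ne (by omega : 1 < e.card) v
      exact ⟨x, hxv, hx⟩
    obtain ⟨x, hxv, hx⟩ := aux e he
    obtain ⟨y, hyv, hy⟩ := aux f hf
    exact key ⟨x, hxv⟩ ⟨y, hyv⟩ (hG.preconnected _ _) e he f hf hve hx hvf hy
  · intro x hx
    have : Nontrivial {x // x ≠ v} := by
      rw [← Fintype.one_lt_card_iff_nontrivial, Fintype.card_subtype_compl]
      simp
      omega
    obtain ⟨y, hy⟩ := hG.preconnected.exists_adj_of_nontrivial ⟨x, hx⟩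
    exact ⟨_, (h _ _ hy.ne).1 hy, by simp, by simp⟩

/-- The two colors make the link of `v` a graph and its complement, one of which is connected. -/
theorem exists_dominates (hn : 3 ≤ n) (c : Coloring n 2 3) (v : Fin n) :
    ∃ i, Dominates c i v := by
  have : Nontrivial (Fin n) := Fin.nontrivial_iff_two_le.2 (by omega)
  obtain ⟨w, hw⟩ := exists_ne v
  have : Nonempty {x // x ≠ v} := ⟨⟨w, hw⟩⟩
  let G : SimpleGraph {x // x ≠ v} := SimpleGraph.mk
    (fun x y => x ≠ y ∧ ({v, x.1, y.1} : Finset (Fin n)) ∈ colorClass c 0)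
    ⟨fun x y h => ⟨h.1.symm, by rw [Finset.pair_comm]; exact h.2⟩⟩ ⟨fun x h => h.1 rfl⟩
  rcases G.connected_or_connected_compl with h | h
  · exact ⟨0, dominates_of_connected hn h fun x y hxy => by simp [G, hxy]⟩
  · refine ⟨1, dominates_of_connected hn h fun x y hxy => ?_⟩
    have hc : ({v, x.1, y.1} : Finset (Fin n)).card = 3 :=
      Finset.card_eq_three.2 ⟨v, x, y, x.2.symm, y.2.symm, fun h => hxy (Subtype.ext h), rfl⟩
    rw [SimpleGraph.compl_adj]
    simp only [G, hxy, ne_eq, not_false_eq_true, true_and]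
    constructor
    · exact (mem_colorClass_or (by decide) hc).resolve_left
    · exact fun h1 h0 => absurd (eq_of_mem_colorClass h0 h1) (by decide)

/-- Since `u` covers `v`, some edge of color `i` contains both and links the edges at `u` to those
at `v`. -/
theorem Dominates.tightConn {c : Coloring n 2 3} {i : Fin 2} {u v : Fin n} {e f : Finset (Fin n)}
    (hu : Dominates c i u) (hv : Dominates c i v) (he : e ∈ colorClass c i)
    (hf : f ∈ colorClass c i) (hue : u ∈ e) (hvf : v ∈ f) :
    TightConn 2 (colorClass c i) e f := by
  by_cases huv : u = v
  · subst huv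
    exact hu.1 e he f hf hue hvf
  · obtain ⟨g, hg, hug, hvg⟩ := hu.2 v (Ne.symm huv)
    exact (hu.1 e he g hg hue hug).trans (hv.1 g hg f hf hvg hvf)

end Dominance

/-! ### Shadows of vertices and of pairs -/

section SmallShadows

variable {n t : ℕ}

theorem maxShadow_one_le (c : Coloring n 2 3) : maxShadow t 1 c ≤ n := by
  refine maxShadow_le fun i e _ => ?_
  refine (Finset.card_le_card (t := Finset.powersetCard 1 Finset.univ) fun S hS => ?_).trans ?_
  · simpa [Finset.mem_powersetCard] using (mem_shadow.1 hS).1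
  · simp

theorem le_maxShadow_one (hn : 3 ≤ n) (c : Coloring n 2 3) : n ≤ maxShadow 2 1 c := by
  classical
  let v : Fin n := ⟨0, by omega⟩
  let w : Fin n := ⟨1, by omega⟩
  have hwv : w ≠ v := by simp [v, w]
  obtain ⟨i, hi, hcov⟩ := exists_dominates hn c v
  obtain ⟨e, he, hve, hwe⟩ := hcov w hwv
  refine le_trans ?_ (card_shadow_tightComponent_le (s := 1) (t := 2) c he)
  calc n = (Finset.powersetCard 1 (Finset.univ : Finset (Fin n))).card := by simp
    _ ≤ _ := Finset.card_le_card fun S hS => ?_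
  rw [Finset.mem_powersetCard] at hS
  obtain ⟨x, rfl⟩ := Finset.card_eq_one.1 hS.2
  refine mem_shadow.2 ⟨hS.2, ?_⟩
  by_cases hx : x = v
  · subst hx
    exact ⟨e, mem_tightComponent.2 ⟨he, .refl⟩, by simpa⟩
  · obtain ⟨f, hf, hvf, hxf⟩ := hcov x hx
    exact ⟨f, mem_tightComponent.2 ⟨hf, hi e he f hf hve hvf⟩, by simpa⟩

theorem M_shadow_one (hn : 3 ≤ n) (ht : t ≤ 2) : M n 2 3 t 1 = n := by
  refine le_antisymm ?_ (le_M fun c => (le_maxShadow_one hn c).trans (maxShadow_anti c ht))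
  obtain ⟨c, hc⟩ := exists_maxShadow_eq n 3 t 1
  exact hc ▸ maxShadow_one_le c

/-- If all vertices of `S` dominate in color `i`, some component of color `i` has all pairs that
meet `S` in its shadow. -/
theorem card_pairs_le_maxShadow (hn : 3 ≤ n) (c : Coloring n 2 3) (i : Fin 2)
    {S : Finset (Fin n)} (hS : S.Nonempty) (hd : ∀ v ∈ S, Dominates c i v) :
    n.choose 2 - (n - S.card).choose 2 ≤ maxShadow 2 2 c := by
  classical
  have : Nontrivial (Fin n) := Fin.nontrivial_iff_two_le.2 (by omega)
  obtain ⟨v, hv⟩ := hS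
  obtain ⟨w, hw⟩ := exists_ne v
  obtain ⟨e, he, hve, -⟩ := (hd v hv).2 w hw
  refine le_trans ?_ (card_shadow_tightComponent_le (s := 2) (t := 2) c he)
  have h1 : (Finset.powersetCard 2 (Finset.univ : Finset (Fin n))).card = n.choose 2 := by simp
  have h2 : (Finset.powersetCard 2 Sᶜ).card = (n - S.card).choose 2 := by
    simp [Finset.card_compl]
  rw [← h1, ← h2]
  refine (Finset.le_card_sdiff _ _).trans (Finset.card_le_card fun p hp => ?_)
  simp only [Finset.mem_sdiff, Finset.mem_powersetCard, Finset.subset_univ, true_and,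
    not_and'] at hp
  have hp2 := hp.2 hp.1
  obtain ⟨x, hxp, hxS⟩ := Finset.not_subset.1 hp2
  rw [Finset.mem_compl, not_not] at hxS
  obtain ⟨y, hyp, hyx⟩ := Finset.exists_mem_ne (by omega : 1 < p.card) x
  have hpe : p = {x, y} := by
    refine (Finset.eq_of_subset_of_card_le ?_ ?_).symm
    · simp [Finset.insert_subset_iff, hxp, hyp]
    · rw [Finset.card_pair hyx.symm, hp.1]
  obtain ⟨f, hf, hxf, hyf⟩ := (hd x hxS).2 y hyx
  refine mem_shadow.2 ⟨hp.1, f, mem_tightComponent.2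
    ⟨hf, (hd v hv).tightConn (hd x hxS) he hf hve hxf⟩, ?_⟩
  rw [hpe]
  simp [Finset.insert_subset_iff, hxf, hyf]

/-- A choice of a dominating color for every vertex. -/
theorem exists_dominates_fun (hn : 3 ≤ n) (c : Coloring n 2 3) :
    ∃ δ : Fin n → Fin 2, ∀ v, Dominates c (δ v) v :=
  ⟨fun v => (exists_dominates hn c v).choose, fun v => (exists_dominates hn c v).choose_spec⟩

theorem card_filter_color_add (δ : Fin n → Fin 2) :
    (Finset.univ.filter fun v => δ v = 0).card + (Finset.univ.filter fun v => δ v = 1).card = n := by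
  have := Finset.card_filter_add_card_filter_not (s := (Finset.univ : Finset (Fin n)))
    (fun v => δ v = 0)
  rw [Finset.card_univ, Fintype.card_fin] at this
  convert this using 4
  omega

theorem le_maxShadow_two (hn : 3 ≤ n) (c : Coloring n 2 3) :
    n.choose 2 - (n / 2).choose 2 ≤ maxShadow 2 2 c := by
  obtain ⟨δ, hδ⟩ := exists_dominates_fun hn c
  have h := card_filter_color_add δ
  -- The more frequent color is chosen by at least `⌈n/2⌉` vertices, so at most `⌊n/2⌋` remain,
  -- matching the upper bound.
  obtain ⟨i, hi⟩ : ∃ i, n - n / 2 ≤ (Finset.univ.filter fun v => δ v = i).card := by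
    by_contra! hi
    have := hi 0
    have := hi 1
    omega
  refine le_trans ?_ (card_pairs_le_maxShadow hn c i (Finset.card_pos.1 (by omega :
    0 < (Finset.univ.filter fun v => δ v = i).card)) fun v hv => ?_)
  · exact Nat.sub_le_sub_left (Nat.choose_le_choose _ (by omega)) _
  · simp only [Finset.mem_filter, Finset.mem_univ, true_and] at hv
    exact hv ▸ hδ v

theorem card_shadow_two_le {H : Finset (Finset (Fin n))} {B : Finset (Fin n)}
    (h : ∀ e ∈ H, (e ∩ B).card ≤ 1) :
    (shadow 2 H).card ≤ n.choose 2 - B.card.choose 2 := by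
  classical
  have h1 : (Finset.powersetCard 2 (Finset.univ : Finset (Fin n))).card = n.choose 2 := by simp
  rw [← h1, ← Finset.card_powersetCard 2 B,
    ← Finset.card_sdiff_of_subset (Finset.powersetCard_mono (Finset.subset_univ _))]
  refine Finset.card_le_card fun S hS => ?_
  obtain ⟨hS2, e, he, hSe⟩ := mem_shadow.1 hS
  simp only [Finset.mem_sdiff, Finset.mem_powersetCard, Finset.subset_univ, true_and]
  refine ⟨hS2, fun hB => ?_⟩
  have := Finset.card_le_card (Finset.subset_inter hSe hB.1)
  have := h e he
  omega

theorem M_one_two_le (n : ℕ) : M n 2 3 1 2 ≤ n.choose 2 - (n / 2).choose 2 := by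
  classical
  obtain ⟨A, -, hA⟩ := Finset.exists_subset_card_eq
    (by simp; omega : n / 2 ≤ (Finset.univ : Finset (Fin n)).card)
  have hAc : Aᶜ.card = n - n / 2 := by simp [Finset.card_compl, hA]
  -- Color `0` misses all pairs inside `Aᶜ`. An edge of color `1` has two vertices in `Aᶜ`, hence at
  -- most one in `A`, so color `1` misses all pairs inside `A`, the smaller half.
  refine (M_le (coloringOf 3 fun e => (e ∩ Aᶜ).card ≤ 1)).trans (maxShadow_le fun i e _ => ?_)
  refine (Finset.card_le_card (shadow_mono (H' := colorClass _ i)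
    fun f hf => (mem_tightComponent.1 hf).1)).trans ?_
  obtain rfl | rfl : i = 0 ∨ i = 1 := by omega
  · refine (card_shadow_two_le (B := Aᶜ) fun e he => (mem_colorClass_zero.1 he).2).trans ?_
    exact Nat.sub_le_sub_left (Nat.choose_le_choose _ (by omega)) _
  · rw [← hA]
    refine card_shadow_two_le fun e he => ?_
    obtain ⟨h3, h⟩ := mem_colorClass_one.1 he
    have h1 : (e ∩ A).card + (e ∩ Aᶜ).card = e.card := by
      rw [← Finset.sdiff_eq_inter_compl, Finset.card_inter_add_card_sdiff]
    omega

theorem M_shadow_two (hn : 3 ≤ n) (ht : 1 ≤ t) (ht' : t ≤ 2) :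
    (M n 2 3 t 2 : ℤ) = (n.choose 2 : ℤ) - ((n / 2).choose 2 : ℤ) := by
  rw [← Nat.cast_sub (Nat.choose_le_choose _ (Nat.div_le_self _ _)), Nat.cast_inj]
  exact le_antisymm ((M_anti ht).trans (M_one_two_le n))
    (le_M fun c => (le_maxShadow_two hn c).trans (maxShadow_anti c ht'))

end SmallShadows

/-! ### Binomial estimates and the constant `6√21 - 27` -/

section Asymptotics

open Filter Topology

theorem cast_choose_three (n : ℕ) : (n.choose 3 : ℝ) = n * (n - 1) * (n - 2) / 6 := by
  induction n with
  | zero => simp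
  | succ n ih =>
    rw [Nat.choose_succ_succ' n 2, Nat.cast_add, ih, Nat.cast_choose_two]
    push_cast
    ring

theorem choose_three_le (n : ℕ) : (n.choose 3 : ℝ) ≤ (n : ℝ) ^ 3 / 6 := by
  have := Nat.choose_le_pow_div (α := ℝ) 3 n
  norm_num [Nat.factorial] at this
  exact this

theorem le_choose_three (n : ℕ) : (n : ℝ) ^ 3 / 6 - (n : ℝ) ^ 2 / 2 ≤ n.choose 3 := by
  rw [cast_choose_three]
  have : (0 : ℝ) ≤ n := n.cast_nonneg
  nlinarith

/-- This counts the triples meeting both a set of size `w` and its complement. -/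
theorem choose_three_sub_sub {n w : ℕ} (hw : w ≤ n) :
    (n.choose 3 : ℝ) - w.choose 3 - (n - w).choose 3 = w * (n - w) * (n - 2) / 2 := by
  rw [cast_choose_three, cast_choose_three, cast_choose_three, Nat.cast_sub hw]
  ring

theorem tendsto_cube_div_choose_three :
    Tendsto (fun n : ℕ => (n : ℝ) ^ 3 / n.choose 3) atTop (𝓝 6) := by
  have h0 : Tendsto (fun n : ℕ => (n : ℝ)⁻¹) atTop (𝓝 0) := tendsto_inv_atTop_nhds_zero_nat
  have h1 : Tendsto (fun n : ℕ => 6 / ((1 - (n : ℝ)⁻¹) * (1 - 2 * (n : ℝ)⁻¹))) atTop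
      (𝓝 (6 / ((1 - 0) * (1 - 2 * 0)))) :=
    tendsto_const_nhds.div ((tendsto_const_nhds.sub h0).mul
      (tendsto_const_nhds.sub (tendsto_const_nhds.mul h0))) (by norm_num)
  norm_num at h1
  refine h1.congr' ?_
  filter_upwards [eventually_ge_atTop 3] with n hn
  have hn' : (3 : ℝ) ≤ n := by exact_mod_cast hn
  have e1 : (n : ℝ) ≠ 0 := by linarith
  have e2 : (n : ℝ) - 1 ≠ 0 := by linarith
  have e3 : (n : ℝ) - 2 ≠ 0 := by linarith
  rw [cast_choose_three]
  field_simp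

/-- The quadratic term is negligible, so bounds for finite `n` may carry any error of order `n ^ 2`.
-/
theorem tendsto_density (L K : ℝ) :
    Tendsto (fun n : ℕ => ((n.choose 3 : ℕ) : ℝ)⁻¹ * (L * (n : ℝ) ^ 3 / 6 + K * (n : ℝ) ^ 2))
      atTop (𝓝 L) := by
  have h0 : Tendsto (fun n : ℕ => (n : ℝ)⁻¹) atTop (𝓝 0) := tendsto_inv_atTop_nhds_zero_nat
  have h1 := tendsto_cube_div_choose_three.mul
    ((tendsto_const_nhds (x := L / 6)).add ((tendsto_const_nhds (x := K)).mul h0))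
  have : 6 * (L / 6 + K * 0) = L := by ring
  rw [this] at h1
  refine h1.congr' ?_
  filter_upwards [eventually_ge_atTop 1] with n hn
  have e1 : (n : ℝ) ≠ 0 := by positivity
  rw [div_eq_mul_inv]
  field_simp

/-- The optimal proportion of the larger part, the positive root of `x ^ 2 + 3 * x - 3`. -/
noncomputable def optRatio : ℝ := (Real.sqrt 21 - 3) / 2

theorem optRatio_sq : optRatio ^ 2 = 3 - 3 * optRatio := by
  have := Real.sq_sqrt (show (0 : ℝ) ≤ 21 by norm_num)
  unfold optRatio
  linarith

theorem optRatio_cube : optRatio ^ 3 = 6 * Real.sqrt 21 - 27 := by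
  have : optRatio ^ 3 = 12 * optRatio - 9 := by
    have h := optRatio_sq
    linear_combination (optRatio - 3) * h
  rw [this]
  unfold optRatio
  ring

theorem sqrt_twentyOne_bounds : 4.5825 < Real.sqrt 21 ∧ Real.sqrt 21 < 4.5826 :=
  ⟨Real.lt_sqrt_of_sq_lt (by norm_num), (Real.sqrt_lt' (by norm_num)).2 (by norm_num)⟩

theorem optRatio_bounds : 0.791 < optRatio ∧ optRatio < 0.792 := by
  obtain ⟨h1, h2⟩ := sqrt_twentyOne_bounds
  unfold optRatio
  constructor <;> norm_num at * <;> linarith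

end Asymptotics

/-! ### The case `t = 1`, `s = 3` -/

section OneTight

variable {n : ℕ} {H : Finset (Finset (Fin n))} {x y z v : Fin n}

/-- Two vertices are connected in `H` if they are equal or lie in `1`-connected edges. -/
def VertexConn (H : Finset (Finset (Fin n))) (x y : Fin n) : Prop :=
  x = y ∨ ∃ e ∈ H, ∃ f ∈ H, x ∈ e ∧ y ∈ f ∧ TightConn 1 H e f

theorem VertexConn.symm (h : VertexConn H x y) : VertexConn H y x := by
  rcases h with rfl | ⟨e, he, f, hf, hx, hy, h⟩
  · exact Or.inl rfl
  · exact Or.inr ⟨f, hf, e, he, hy, hx, TightConn.symm h⟩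

theorem VertexConn.trans (h : VertexConn H x y) (h' : VertexConn H y z) : VertexConn H x z := by
  rcases h with rfl | ⟨e, he, f, hf, hx, hy, h⟩
  · exact h'
  rcases h' with rfl | ⟨e', he', f', hf', hx', hy', h'⟩
  · exact Or.inr ⟨e, he, f, hf, hx, hy, h⟩
  · exact Or.inr ⟨e, he, f', hf', hx, hy',
      (h.trans (tightConn_of_mem_one hf he' hy hx')).trans h'⟩

theorem VertexConn.of_mem {e : Finset (Fin n)} (he : e ∈ H) (hx : x ∈ e) (hy : y ∈ e) :
    VertexConn H x y :=
  Or.inr ⟨e, he, e, he, hx, hy, .refl⟩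

theorem VertexConn.tightConn {e f : Finset (Fin n)} (h : VertexConn H x y) (he : e ∈ H)
    (hf : f ∈ H) (hx : x ∈ e) (hy : y ∈ f) : TightConn 1 H e f := by
  rcases h with rfl | ⟨e', he', f', hf', hx', hy', h⟩
  · exact tightConn_of_mem_one he hf hx hy
  · exact ((tightConn_of_mem_one he he' hx hx').trans h).trans
      (tightConn_of_mem_one hf' hf hy' hy)

open Classical in
/-- The set of all vertices connected to `v` in `H`. -/
noncomputable def vertexComponent (H : Finset (Finset (Fin n))) (v : Fin n) : Finset (Fin n) :=
  Finset.univ.filter fun x => VertexConn H v x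

theorem mem_vertexComponent : x ∈ vertexComponent H v ↔ VertexConn H v x := by
  simp [vertexComponent]

theorem self_mem_vertexComponent : v ∈ vertexComponent H v :=
  mem_vertexComponent.2 (Or.inl rfl)

theorem subset_vertexComponent {e : Finset (Fin n)} (he : e ∈ H) (hx : x ∈ e)
    (hv : x ∈ vertexComponent H v) : e ⊆ vertexComponent H v := fun _ hy =>
  mem_vertexComponent.2 ((mem_vertexComponent.1 hv).trans (.of_mem he hx hy))

/-- Edges meeting the vertex component are pairwise `1`-connected; the others are triples of its
complement. -/
theorem card_colorClass_le_maxShadow_add (c : Coloring n 2 3) (i : Fin 2) (v : Fin n) :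
    (colorClass c i).card ≤ maxShadow 1 3 c +
      (n - (vertexComponent (colorClass c i) v).card).choose 3 := by
  classical
  set W := vertexComponent (colorClass c i) v with hW
  have h2 : (Finset.powersetCard 3 Wᶜ).card = (n - W.card).choose 3 := by
    simp [Finset.card_compl]
  rw [← h2]
  let X := (colorClass c i).filter fun e => ∃ x ∈ e, x ∈ W
  have hX : X.card ≤ maxShadow 1 3 c := by
    refine card_le_maxShadow c (Finset.filter_subset _ _) fun e he f hf => ?_
    obtain ⟨he, x, hx, hxW⟩ := Finset.mem_filter.1 he
    obtain ⟨hf, y, hy, hyW⟩ := Finset.mem_filter.1 hf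
    exact VertexConn.tightConn ((mem_vertexComponent.1 hxW).symm.trans
      (mem_vertexComponent.1 hyW)) he hf hx hy
  refine le_trans ?_ (Nat.add_le_add_right hX _)
  refine (Finset.card_le_card fun e he => ?_).trans (Finset.card_union_le _ _)
  rw [Finset.mem_union, Finset.mem_powersetCard]
  by_cases h : ∃ x ∈ e, x ∈ W
  · exact Or.inl (Finset.mem_filter.2 ⟨he, h⟩)
  · push Not at h
    exact Or.inr ⟨fun x hx => Finset.mem_compl.2 (h x hx), card_of_mem_colorClass he⟩

/-- No edge of the color crosses the boundary of a vertex component. -/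
theorem card_colorClass_le_choose_add (c : Coloring n 2 3) (i : Fin 2) (v : Fin n) :
    (colorClass c i).card ≤ (vertexComponent (colorClass c i) v).card.choose 3 +
      (n - (vertexComponent (colorClass c i) v).card).choose 3 := by
  classical
  set W := vertexComponent (colorClass c i) v with hW
  have h2 : (Finset.powersetCard 3 Wᶜ).card = (n - W.card).choose 3 := by
    simp [Finset.card_compl]
  rw [← h2, ← Finset.card_powersetCard 3 W]
  refine (Finset.card_le_card fun e he => ?_).trans (Finset.card_union_le _ _)
  rw [Finset.mem_union, Finset.mem_powersetCard, Finset.mem_powersetCard]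
  by_cases h : ∃ x ∈ e, x ∈ W
  · obtain ⟨x, hx, hxW⟩ := h
    exact Or.inl ⟨subset_vertexComponent he hx hxW, card_of_mem_colorClass he⟩
  · push Not at h
    exact Or.inr ⟨fun x hx => Finset.mem_compl.2 (h x hx), card_of_mem_colorClass he⟩

theorem card_filter_mem_le_choose_two {W : Finset (Fin n)} {X : Finset (Finset (Fin n))}
    (hX : ∀ e ∈ X, e.card = 3 ∧ v ∈ e ∧ e.erase v ⊆ W) : X.card ≤ W.card.choose 2 := by
  classical
  rw [← Finset.card_powersetCard 2 W]
  refine Finset.card_le_card_of_injOn (fun e => e.erase v) ?_ ?_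
  · intro e he
    obtain ⟨h1, h2, h3⟩ := hX e he
    simp only [Finset.mem_coe, Finset.mem_powersetCard]
    exact ⟨h3, by rw [Finset.card_erase_of_mem h2, h1]⟩
  · intro e he f hf h
    rw [← Finset.insert_erase (hX e he).2.1, ← Finset.insert_erase (hX f hf).2.1]
    exact congrArg (insert v) h

theorem sum_card_filter_mem {H : Finset (Finset (Fin n))} {k : ℕ} (hH : ∀ e ∈ H, e.card = k) :
    ∑ v : Fin n, (H.filter fun e => v ∈ e).card = k * H.card := by
  have := Finset.sum_card_bipartiteAbove_eq_sum_card_bipartiteBelow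
    (s := (Finset.univ : Finset (Fin n))) (t := H) (fun v e => v ∈ e)
  simp only [Finset.bipartiteAbove, Finset.bipartiteBelow] at this
  rw [this, mul_comm, ← smul_eq_mul, ← Finset.sum_const]
  refine Finset.sum_congr rfl fun e he => ?_
  rw [← hH e he]
  congr 1
  ext
  simp

/-- Double counting: an edge at `v` is determined by a pair inside the component of `v`. This is
useful when all components are small. -/
theorem three_mul_card_colorClass_le (c : Coloring n 2 3) (i : Fin 2) :
    3 * (colorClass c i).card ≤
      ∑ v, (vertexComponent (colorClass c i) v).card.choose 2 := by
  rw [← sum_card_filter_mem fun e he => card_of_mem_colorClass he]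
  refine Finset.sum_le_sum fun v _ => card_filter_mem_le_choose_two (v := v) fun e he => ?_
  obtain ⟨h1, h2⟩ := Finset.mem_filter.1 he
  exact ⟨card_of_mem_colorClass h1, h2, (Finset.erase_subset _ _).trans
    (subset_vertexComponent h1 h2 self_mem_vertexComponent)⟩

/-- Every triple crossing the boundary of a component of color `i` has color `j`, so color `j`
connects all vertices. -/
theorem card_colorClass_le_of_disconnected (hn : 3 ≤ n) (c : Coloring n 2 3) {i j : Fin 2}
    (hij : i ≠ j) {v w : Fin n} (hw : w ∉ vertexComponent (colorClass c i) v) :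
    (colorClass c j).card ≤ maxShadow 1 3 c := by
  classical
  set W := vertexComponent (colorClass c i) v with hW
  have key : ∀ x ∈ W, ∀ y ∉ W, VertexConn (colorClass c j) x y := by
    intro x hx y hy
    have hxy : x ≠ y := fun h => hy (h ▸ hx)
    obtain ⟨z, hz⟩ := Finset.exists_mem_notMem_of_card_lt_card
      (s := {x, y}) (t := (Finset.univ : Finset (Fin n)))
      (by rw [Finset.card_pair hxy]; simp; omega)
    simp only [Finset.mem_univ, Finset.mem_insert, Finset.mem_singleton, true_and, not_or] at hz
    have hc : ({x, y, z} : Finset (Fin n)).card = 3 :=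
      Finset.card_eq_three.2 ⟨x, y, z, hxy, Ne.symm hz.1, Ne.symm hz.2, rfl⟩
    refine .of_mem ((mem_colorClass_or hij hc).resolve_left fun h => hy ?_)
      (by simp : x ∈ ({x, y, z} : Finset (Fin n))) (by simp)
    exact subset_vertexComponent h (by simp : x ∈ ({x, y, z} : Finset (Fin n))) hx (by simp)
  have hv : v ∈ W := self_mem_vertexComponent
  have all : ∀ x, VertexConn (colorClass c j) v x := fun x => by
    by_cases hx : x ∈ W
    · exact (key v hv w hw).trans (key x hx w hw).symm
    · exact key v hv x hx
  refine card_le_maxShadow c subset_rfl fun e he f hf => ?_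
  have hne : ∀ e ∈ colorClass c j, e.Nonempty := fun e he =>
    Finset.card_pos.1 (by rw [card_of_mem_colorClass he]; omega)
  obtain ⟨x, hx⟩ := hne e he
  obtain ⟨y, hy⟩ := hne f hf
  exact ((all x).symm.trans (all y)).tightConn he hf hx hy

/-- Color `j` is one component, so many edges of color `j` suffice. Write `x` for `optRatio`; the
cases are a component of size at least `x * n`, a largest one between `(1 - x) * n` and `x * n`, and
only smaller ones. -/
theorem le_maxShadow_three_of_disconnected (hn : 3 ≤ n) (c : Coloring n 2 3) {i j : Fin 2}
    (hij : i ≠ j) {v w : Fin n} (hw : w ∉ vertexComponent (colorClass c i) v) :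
    optRatio ^ 3 * (n : ℝ) ^ 3 / 6 - (n : ℝ) ^ 2 ≤ maxShadow 1 3 c := by
  obtain ⟨b1, b2⟩ := optRatio_bounds
  have hsq := optRatio_sq
  have hcube : optRatio ^ 3 = 3 * optRatio * (1 - optRatio) := by
    calc optRatio ^ 3 = optRatio * optRatio ^ 2 := by ring
      _ = _ := by rw [hsq]; ring
  have hj : ((colorClass c j).card : ℝ) ≤ maxShadow 1 3 c := by
    exact_mod_cast card_colorClass_le_of_disconnected hn c hij hw
  have hN : ((colorClass c i).card : ℝ) + (colorClass c j).card = n.choose 3 := by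
    exact_mod_cast card_colorClass_add c hij
  have hNle := le_choose_three n
  have hn' : (3 : ℝ) ≤ n := by exact_mod_cast hn
  by_cases h1 : ∃ u, optRatio * n ≤ (vertexComponent (colorClass c i) u).card
  · obtain ⟨u, hu⟩ := h1
    have h := card_colorClass_le_maxShadow_add c i u
    set a := (vertexComponent (colorClass c i) u).card
    have ha : a ≤ n := (Finset.card_le_univ _).trans (by simp)
    have h' : ((colorClass c i).card : ℝ) ≤ maxShadow 1 3 c + (n - a).choose 3 := by
      exact_mod_cast h
    have h3 := choose_three_le (n - a)
    have h4 : ((n - a : ℕ) : ℝ) ≤ (1 - optRatio) * n := by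
      rw [Nat.cast_sub ha]; linarith
    have h5 : ((n - a : ℕ) : ℝ) ^ 3 ≤ ((1 - optRatio) * n) ^ 3 :=
      pow_le_pow_left₀ (Nat.cast_nonneg _) h4 3
    -- From `x ^ 3 = 3x(1 - x)` one gets `(1 - x) ^ 3 = 1 - 2x ^ 3`. Adding the bounds for both
    -- colors then gives twice the claimed value.
    have h6 : ((1 - optRatio) * n) ^ 3 = (1 - 2 * optRatio ^ 3) * (n : ℝ) ^ 3 := by
      rw [mul_pow]
      congr 1
      have : (1 - optRatio) ^ 3 = 1 - 3 * optRatio * (1 - optRatio) - optRatio ^ 3 := by ring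
      rw [this, ← hcube]
      ring
    nlinarith
  · push Not at h1
    by_cases h2 : ∃ u, (1 - optRatio) * n ≤ (vertexComponent (colorClass c i) u).card
    · obtain ⟨u, hu⟩ := h2
      have h := card_colorClass_le_choose_add c i u
      have hu' := h1 u
      set a := (vertexComponent (colorClass c i) u).card
      have ha : a ≤ n := (Finset.card_le_univ _).trans (by simp)
      have h' : ((colorClass c i).card : ℝ) ≤ a.choose 3 + (n - a).choose 3 := by
        exact_mod_cast h
      have h3 := choose_three_sub_sub ha
      -- By concavity `a(n - a)` is at least its value at the ends of the interval; the crossing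
      -- triples all have color `j`.
      have h4 : optRatio * (1 - optRatio) * (n : ℝ) ^ 2 ≤ a * (n - a) := by nlinarith
      have h5 : optRatio * (1 - optRatio) * (n : ℝ) ^ 2 * (n - 2) ≤ a * (n - a) * (n - 2) :=
        mul_le_mul_of_nonneg_right h4 (by linarith)
      have h6 : 0 ≤ (1 - optRatio * (1 - optRatio)) * (n : ℝ) ^ 2 := by
        apply mul_nonneg _ (by positivity)
        nlinarith
      rw [hcube]
      nlinarith
    · push Not at h2
      have h : (3 * (colorClass c i).card : ℝ) ≤
          ∑ v, ((vertexComponent (colorClass c i) v).card.choose 2 : ℝ) := by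
        exact_mod_cast three_mul_card_colorClass_le c i
      -- The bound is crude, as `1 - x < 0.21`: color `i` then has density at most `0.09`, and color
      -- `j` far more than needed.
      have h3 : ∀ v ∈ (Finset.univ : Finset (Fin n)),
          ((vertexComponent (colorClass c i) v).card.choose 2 : ℝ) ≤ (3 / 10 * n) ^ 2 / 2 := by
        intro v _
        have hv := h2 v
        set a := (vertexComponent (colorClass c i) v).card
        have h4 := Nat.choose_le_pow_div (α := ℝ) 2 a
        norm_num [Nat.factorial] at h4
        have h5 : (a : ℝ) ≤ 3 / 10 * n := by nlinarith
        have := pow_le_pow_left₀ (Nat.cast_nonneg a) h5 2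
        linarith
      have h4 := h.trans (Finset.sum_le_card_nsmul _ _ _ h3)
      simp only [Finset.card_univ, Fintype.card_fin, nsmul_eq_mul] at h4
      have h5 : optRatio ^ 3 ≤ 3 / 5 := by rw [hcube]; nlinarith
      have h6 := mul_le_mul_of_nonneg_right h5 (by positivity : (0 : ℝ) ≤ (n : ℝ) ^ 3)
      nlinarith [sq_nonneg (n : ℝ), (by positivity : (0 : ℝ) ≤ (n : ℝ) ^ 3)]

theorem le_maxShadow_three (hn : 3 ≤ n) (c : Coloring n 2 3) :
    optRatio ^ 3 * (n : ℝ) ^ 3 / 6 - (n : ℝ) ^ 2 ≤ maxShadow 1 3 c := by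
  by_cases h : ∃ i, ∃ v w, w ∉ vertexComponent (colorClass c i) v
  · obtain ⟨i, v, w, hw⟩ := h
    obtain ⟨j, hj⟩ := exists_ne i
    exact le_maxShadow_three_of_disconnected hn c hj.symm hw
  · push Not at h
    have hi : ∀ i, (colorClass c i).card ≤ maxShadow 1 3 c := fun i => by
      have h1 := card_colorClass_le_maxShadow_add c i ⟨0, by omega⟩
      rwa [Finset.eq_univ_of_forall (h i ⟨0, by omega⟩), Finset.card_univ, Fintype.card_fin,
        Nat.sub_self, Nat.choose_zero_succ, add_zero] at h1
    have hN : ((colorClass c 0).card : ℝ) + (colorClass c 1).card = n.choose 3 := by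
      exact_mod_cast card_colorClass_add c (by decide)
    have h0 : ((colorClass c 0).card : ℝ) ≤ maxShadow 1 3 c := by exact_mod_cast hi 0
    have h1 : ((colorClass c 1).card : ℝ) ≤ maxShadow 1 3 c := by exact_mod_cast hi 1
    have hNle := le_choose_three n
    have h5 : optRatio ^ 3 ≤ 1 / 2 := by
      rw [optRatio_cube]
      have := sqrt_twentyOne_bounds.2
      norm_num at *
      linarith
    have h6 := mul_le_mul_of_nonneg_right h5 (by positivity : (0 : ℝ) ≤ (n : ℝ) ^ 3)
    nlinarith [sq_nonneg (n : ℝ)]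

/-- The components of the coloring with color `0` on the edges inside `W` or its complement. -/
theorem maxShadow_coloringOf_split_le (W : Finset (Fin n)) :
    maxShadow 1 3 (coloringOf (n := n) 3 fun e => e ⊆ W ∨ Disjoint e W) ≤
      max (max (W.card.choose 3) ((n - W.card).choose 3))
        (W.card * (n - W.card).choose 2 + W.card.choose 2 * (n - W.card)) := by
  classical
  refine maxShadow_self_le fun i e he => ?_
  obtain rfl | rfl : i = 0 ∨ i = 1 := by omega
  · refine le_max_of_le_left ?_
    have h2 : (Finset.powersetCard 3 Wᶜ).card = (n - W.card).choose 3 := by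
      simp [Finset.card_compl]
    obtain ⟨h3, he | he⟩ := mem_colorClass_zero.1 he
    · refine le_max_of_le_left ?_
      rw [← Finset.card_powersetCard 3 W]
      refine Finset.card_le_card fun f hf => Finset.mem_powersetCard.2
        ⟨?_, card_of_mem_colorClass (mem_tightComponent.1 hf).1⟩
      refine tightComponent_subset_of_closed (X := fun f => f ⊆ W) he (fun f g hf hfg => ?_) f hf
      obtain ⟨-, hg, S, hSf, hSg, hS⟩ := tightAdj_iff.1 hfg
      refine (mem_colorClass_zero.1 hg).2.resolve_right fun hd => ?_
      obtain ⟨x, hx⟩ := Finset.card_pos.1 hS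
      exact Finset.disjoint_left.1 hd (hSg hx) (hf (hSf hx))
    · refine le_max_of_le_right ?_
      rw [← h2]
      refine Finset.card_le_card fun f hf => Finset.mem_powersetCard.2
        ⟨?_, card_of_mem_colorClass (mem_tightComponent.1 hf).1⟩
      rw [Finset.subset_compl_iff_disjoint_right]
      refine tightComponent_subset_of_closed (X := fun f => Disjoint f W) he
        (fun f g hf hfg => ?_) f hf
      obtain ⟨-, hg, S, hSf, hSg, hS⟩ := tightAdj_iff.1 hfg
      refine (mem_colorClass_zero.1 hg).2.resolve_left fun hd => ?_
      obtain ⟨x, hx⟩ := Finset.card_pos.1 hS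
      exact Finset.disjoint_left.1 hf (hSf hx) (hd (hSg hx))
  · refine le_max_of_le_right ?_
    have h1 := card_filter_inter_le W 1 3
    have h2 := card_filter_inter_le W 2 3
    simp only [Nat.choose_one_right, Nat.reduceSub] at h1 h2
    refine le_trans ?_ (Nat.add_le_add h1 h2)
    refine (Finset.card_le_card fun f hf => ?_).trans (Finset.card_union_le _ _)
    obtain ⟨h3, hf⟩ := mem_colorClass_one.1 (mem_tightComponent.1 hf).1
    push Not at hf
    have ha : (f ∩ W).card ≠ 0 := by
      rw [Finset.card_ne_zero, ← Finset.not_disjoint_iff_nonempty_inter]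
      exact hf.2
    have hb : (f ∩ W).card < 3 := by
      rw [← h3]
      refine Finset.card_lt_card (Finset.ssubset_iff_subset_ne.2 ⟨Finset.inter_subset_left, ?_⟩)
      exact fun h => hf.1 (Finset.inter_eq_left.1 h)
    simp only [Finset.mem_union, Finset.mem_filter, Finset.mem_univ, true_and]
    omega

theorem M_one_three_le (n : ℕ) :
    (M n 2 3 1 3 : ℝ) ≤ optRatio ^ 3 * (n : ℝ) ^ 3 / 6 + 2 * (n : ℝ) ^ 2 := by
  rcases Nat.eq_zero_or_pos n with rfl | hn
  · have := M_le (t := 1) (s := 3) (fun _ => 0 : Coloring 0 2 3)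
    have h0 : maxShadow 1 3 (fun _ => 0 : Coloring 0 2 3) ≤ 0 := maxShadow_self_le fun i e he => by
      have := card_of_mem_colorClass he
      rw [Finset.eq_empty_of_isEmpty e] at this
      simp at this
    simp [Nat.le_zero.1 (this.trans h0)]
  obtain ⟨b1, b2⟩ := optRatio_bounds
  have hsq := optRatio_sq
  have hn' : (1 : ℝ) ≤ n := by exact_mod_cast hn
  -- At this proportion the triples inside the large part and the crossing triples have the same
  -- leading term.
  set w := ⌊optRatio * n⌋₊
  have hw1 : (w : ℝ) ≤ optRatio * n := Nat.floor_le (by nlinarith)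
  have hw2 : optRatio * n - 1 < w := Nat.sub_one_lt_floor _
  have hwn : w ≤ n := by
    have : (w : ℝ) ≤ n := by nlinarith
    exact_mod_cast this
  obtain ⟨W, -, hW⟩ := Finset.exists_subset_card_eq
    (by simpa using hwn : w ≤ (Finset.univ : Finset (Fin n)).card)
  have h := (M_le (t := 1) (s := 3) _).trans (maxShadow_coloringOf_split_le W)
  rw [hW] at h
  have h' : (M n 2 3 1 3 : ℝ) ≤ max (max (w.choose 3 : ℝ) ((n - w).choose 3))
      (w * (n - w).choose 2 + w.choose 2 * (n - w : ℕ)) := by exact_mod_cast h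
  refine h'.trans (max_le (max_le ?_ ?_) ?_)
  · have h1 := choose_three_le w
    have h2 := pow_le_pow_left₀ (Nat.cast_nonneg w) hw1 3
    rw [mul_pow] at h2
    nlinarith [sq_nonneg (n : ℝ)]
  · have h1 := choose_three_le (n - w)
    have h3 : ((n - w : ℕ) : ℝ) ≤ optRatio * n + 1 := by
      rw [Nat.cast_sub hwn]
      nlinarith
    have h2 := pow_le_pow_left₀ (Nat.cast_nonneg (n - w)) h3 3
    have h4 : (optRatio * n + 1) ^ 3 = optRatio ^ 3 * (n : ℝ) ^ 3 +
      3 * optRatio ^ 2 * (n : ℝ) ^ 2 + 3 * (optRatio * n) + 1 := by ring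
    have h5 : 3 * optRatio ^ 2 * (n : ℝ) ^ 2 ≤ 3 * (n : ℝ) ^ 2 := by
      have : optRatio ^ 2 ≤ 1 := by nlinarith
      nlinarith [sq_nonneg (n : ℝ)]
    nlinarith
  · rw [Nat.cast_choose_two, Nat.cast_choose_two, Nat.cast_sub hwn]
    have h1 : (w : ℝ) * ((n - w) * (n - w - 1) / 2) + w * (w - 1) / 2 * (n - w) =
      w * (n - w) * (n - 2) / 2 := by ring
    rw [h1]
    have hcube : optRatio ^ 3 = 3 * optRatio * (1 - optRatio) := by
      calc optRatio ^ 3 = optRatio * optRatio ^ 2 := by ring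
        _ = _ := by rw [hsq]; ring
    have hwn' : (0 : ℝ) ≤ n - w := by
      have : (w : ℝ) ≤ n := by exact_mod_cast hwn
      linarith
    have h2 : (w : ℝ) * (n - w) ≤ optRatio * n * ((1 - optRatio) * n + 1) :=
      mul_le_mul hw1 (by linarith) hwn' (by nlinarith)
    have h3 : (w : ℝ) * (n - w) * (n - 2) ≤ w * (n - w) * n :=
      mul_le_mul_of_nonneg_left (by linarith) (mul_nonneg (Nat.cast_nonneg _) hwn')
    have h4 := mul_le_mul_of_nonneg_right h2 (Nat.cast_nonneg n : (0 : ℝ) ≤ n)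
    rw [hcube]
    nlinarith [sq_nonneg (n : ℝ)]

theorem tendsto_M_one_three :
    Filter.Tendsto (fun n : ℕ => ((n.choose 3 : ℕ) : ℝ)⁻¹ * (M n 2 3 1 3 : ℝ))
      Filter.atTop (nhds (6 * Real.sqrt 21 - 27)) := by
  rw [← optRatio_cube]
  refine tendsto_of_tendsto_of_tendsto_of_le_of_le' (tendsto_density _ (-1))
    (tendsto_density _ 2) ?_ ?_
  · filter_upwards [Filter.eventually_ge_atTop 3] with n hn
    refine mul_le_mul_of_nonneg_left ?_ (by positivity)
    obtain ⟨c, hc⟩ := exists_maxShadow_eq n 3 1 3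
    have := le_maxShadow_three hn c
    rw [← hc]
    linarith
  · filter_upwards with n
    exact mul_le_mul_of_nonneg_left (M_one_three_le n) (by positivity)

end OneTight

/-! ### Blowing up a coloring -/

section BlowUp

variable {n N : ℕ}

/-- Two vertices of `e` are mapped to `u` by `φ`. -/
def Doubled (φ : Fin N → Fin n) (e : Finset (Fin N)) (u : Fin n) : Prop :=
  ∃ x ∈ e, ∃ y ∈ e, x ≠ y ∧ φ x = u ∧ φ y = u

theorem Doubled.eq {φ : Fin N → Fin n} {e : Finset (Fin N)} {u v : Fin n} (he : e.card = 3)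
    (hu : Doubled φ e u) (hv : Doubled φ e v) : u = v := by
  by_contra huv
  obtain ⟨x, hx, y, hy, hxy, rfl, h1⟩ := hu
  obtain ⟨z, hz, w, hw, hzw, rfl, h2⟩ := hv
  have h : ({x, y, z, w} : Finset (Fin N)) ⊆ e := by
    simp [Finset.insert_subset_iff, hx, hy, hz, hw]
  have hc : ({x, y, z, w} : Finset (Fin N)).card = 4 := by
    have a1 : x ≠ z := fun h => huv (by rw [h])
    have a2 : x ≠ w := fun h => huv (by rw [h, h2])
    have a3 : y ≠ z := fun h => huv (by rw [← h, h1])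
    have a4 : y ≠ w := fun h => huv (by rw [← h1, h, h2])
    rw [Finset.card_insert_of_notMem, Finset.card_insert_of_notMem, Finset.card_pair hzw] <;>
      simp [*]
  have := Finset.card_le_card h
  omega

theorem not_doubled_of_card_image {φ : Fin N → Fin n} {e : Finset (Fin N)} {u : Fin n}
    (he : e.card = 3) (h : (e.image φ).card = 3) : ¬ Doubled φ e u := by
  rintro ⟨x, hx, y, hy, hxy, rfl, h1⟩
  exact hxy (Finset.card_image_iff.1 (h.trans he.symm) hx hy h1.symm)

theorem card_image_of_not_doubled {φ : Fin N → Fin n} {e : Finset (Fin N)}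
    (he : e.card = 3) (h : ¬ ∃ u, Doubled φ e u) : (e.image φ).card = 3 := by
  rw [Finset.card_image_of_injOn, he]
  intro x hx y hy hxy
  by_contra hne
  exact h ⟨_, x, hx, y, hy, hne, rfl, hxy.symm⟩

open Classical in
/-- The blow-up of the coloring `c` along `φ`: edges with two vertices over `u` get the color
`δ u`, and an edge whose vertices lie over different vertices gets the color of its image. -/
noncomputable def blowUp (c : Coloring n 2 3) (δ : Fin n → Fin 2) (φ : Fin N → Fin n) :
    Coloring N 2 3 := fun e =>
  if h : (e.1.image φ).card = 3 then c ⟨e.1.image φ, h⟩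
  -- The final `0` is never used: a triple whose image has fewer than three vertices is doubled over
  -- some vertex.
  else if h : ∃ u, Doubled φ e.1 u then δ h.choose else 0

variable {c : Coloring n 2 3} {δ : Fin n → Fin 2} {φ : Fin N → Fin n} {i : Fin 2}
  {e g : Finset (Fin N)} {f f' : Finset (Fin n)}

theorem image_mem_colorClass (he : e ∈ colorClass (blowUp c δ φ) i)
    (h : (e.image φ).card = 3) : e.image φ ∈ colorClass c i := by
  obtain ⟨h3, hc⟩ := mem_colorClass.1 he
  refine mem_colorClass.2 ⟨h, ?_⟩
  rw [← hc]
  unfold blowUp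
  rw [dif_pos]

theorem Doubled.color_eq (he : e ∈ colorClass (blowUp c δ φ) i) {u : Fin n}
    (h : Doubled φ e u) : δ u = i := by
  obtain ⟨h3, hc⟩ := mem_colorClass.1 he
  have hn : (e.image φ).card ≠ 3 := fun hi => not_doubled_of_card_image h3 hi h
  have hex : ∃ u, Doubled φ e u := ⟨u, h⟩
  rw [← hc]
  unfold blowUp
  rw [dif_neg (by convert hn), dif_pos hex, h.eq h3 hex.choose_spec]

/-- The edge `f` of color `i` represents the edge `e` of the blow-up: it is the image of `e`, or
it contains the vertex over which `e` has two vertices. -/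
def Represents (c : Coloring n 2 3) (δ : Fin n → Fin 2) (φ : Fin N → Fin n) (i : Fin 2)
    (e : Finset (Fin N)) (f : Finset (Fin n)) : Prop :=
  f ∈ colorClass c i ∧ (e.image φ = f ∨ ∃ u, Doubled φ e u ∧ δ u = i ∧ u ∈ f)

/-- A triple with injective image has only that image as representative; for a doubled one, all
representatives contain the same dominating vertex. -/
theorem Represents.tightConn (hδ : ∀ v, Dominates c (δ v) v) (he : e.card = 3)
    (h : Represents c δ φ i e f) (h' : Represents c δ φ i e f') :
    TightConn 2 (colorClass c i) f f' := by
  obtain ⟨hf, h⟩ := h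
  obtain ⟨hf', h'⟩ := h'
  rcases h with h | ⟨u, hu, hui, huf⟩
  · have h3 : (e.image φ).card = 3 := by rw [h, card_of_mem_colorClass hf]
    rcases h' with h' | ⟨u, hu, -, -⟩
    · rw [← h, ← h']
    · exact absurd hu (not_doubled_of_card_image he h3)
  · rcases h' with h' | ⟨v, hv, -, hvf⟩
    · have h3 : (e.image φ).card = 3 := by rw [h', card_of_mem_colorClass hf']
      exact absurd hu (not_doubled_of_card_image he h3)
    · obtain rfl := hu.eq he hv
      subst hui
      exact (hδ u).1 f hf f' hf' huf hvf

theorem exists_represents_of_ne (hδ : ∀ v, Dominates c (δ v) v)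
    (he : e ∈ colorClass (blowUp c δ φ) i) {p q : Fin N} (hp : p ∈ e) (hq : q ∈ e)
    (hpq : φ p ≠ φ q) : ∃ f, Represents c δ φ i e f ∧ φ p ∈ f ∧ φ q ∈ f := by
  have h3 := card_of_mem_colorClass he
  by_cases h : ∃ u, Doubled φ e u
  · obtain ⟨u, hu⟩ := h
    have hui := hu.color_eq he
    -- Only one vertex of `e` lies off the doubled fibre at most, and `p`, `q` lie in different
    -- fibres.
    have hupq : u = φ p ∨ u = φ q := by
      by_contra! hne
      obtain ⟨x, hx, y, hy, hxy, rfl, h1⟩ := hu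
      have hc : ({x, y, p, q} : Finset (Fin N)).card = 4 := by
        have a0 : p ≠ q := fun h => hpq (by rw [h])
        have a1 : x ≠ p := fun h => hne.1 (by rw [h])
        have a2 : x ≠ q := fun h => hne.2 (by rw [h])
        have a3 : y ≠ p := fun h => hne.1 (by rw [← h, h1])
        have a4 : y ≠ q := fun h => hne.2 (by rw [← h, h1])
        rw [Finset.card_insert_of_notMem, Finset.card_insert_of_notMem, Finset.card_pair a0] <;>
          simp [*]
      have h : ({x, y, p, q} : Finset (Fin N)) ⊆ e := by
        simp [Finset.insert_subset_iff, hx, hy, hp, hq]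
      have := Finset.card_le_card h
      omega
    subst hui
    rcases hupq with rfl | rfl
    · obtain ⟨f, hf, h1, h2⟩ := (hδ (φ p)).2 (φ q) hpq.symm
      exact ⟨f, ⟨hf, Or.inr ⟨_, hu, rfl, h1⟩⟩, h1, h2⟩
    · obtain ⟨f, hf, h1, h2⟩ := (hδ (φ q)).2 (φ p) hpq
      exact ⟨f, ⟨hf, Or.inr ⟨_, hu, rfl, h1⟩⟩, h2, h1⟩
  · exact ⟨e.image φ, ⟨image_mem_colorClass he (card_image_of_not_doubled h3 h), Or.inl rfl⟩,
      Finset.mem_image_of_mem _ hp, Finset.mem_image_of_mem _ hq⟩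

/-- If the shared pair collapses, both edges are doubled over the same vertex and have a common
representative. Otherwise representatives can be chosen to share the image pair. -/
theorem exists_represents_both (hn : 3 ≤ n) (hδ : ∀ v, Dominates c (δ v) v)
    (he : e ∈ colorClass (blowUp c δ φ) i) (hg : g ∈ colorClass (blowUp c δ φ) i) {p q : Fin N}
    (hpq : p ≠ q) (hp : p ∈ e) (hq : q ∈ e) (hp' : p ∈ g) (hq' : q ∈ g) :
    ∃ f f', Represents c δ φ i e f ∧ Represents c δ φ i g f' ∧
      TightConn 2 (colorClass c i) f f' := by
  by_cases h : φ p = φ q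
  · have hu : Doubled φ e (φ p) := ⟨p, hp, q, hq, hpq, rfl, h.symm⟩
    have hu' : Doubled φ g (φ p) := ⟨p, hp', q, hq', hpq, rfl, h.symm⟩
    have hui := hu.color_eq he
    subst hui
    have : Nontrivial (Fin n) := Fin.nontrivial_iff_two_le.2 (by omega)
    obtain ⟨w, hw⟩ := exists_ne (φ p)
    obtain ⟨f, hf, h1, -⟩ := (hδ (φ p)).2 w hw
    exact ⟨f, f, ⟨hf, Or.inr ⟨_, hu, rfl, h1⟩⟩, ⟨hf, Or.inr ⟨_, hu', rfl, h1⟩⟩, .refl⟩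
  · obtain ⟨f, hf, h1, h2⟩ := exists_represents_of_ne hδ he hp hq h
    obtain ⟨f', hf', h3, h4⟩ := exists_represents_of_ne hδ hg hp' hq' h
    exact ⟨f, f', hf, hf', tightConn_of_mem_two h hf.1 hf'.1 h1 h2 h3 h4⟩

/-- The invariant along chains is having a representative in the component of `f`, so a component of
the blow-up projects into one component below. -/
theorem exists_tightConn_of_mem_tightComponent (hn : 3 ≤ n) (hδ : ∀ v, Dominates c (δ v) v)
    (he : e ∈ colorClass (blowUp c δ φ) i) :
    ∃ f ∈ colorClass c i, ∀ g ∈ tightComponent 2 (colorClass (blowUp c δ φ) i) e,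
      (g.image φ).card = 3 → g.image φ ∈ tightComponent 2 (colorClass c i) f := by
  have h3 := card_of_mem_colorClass he
  obtain ⟨p, hp, q, hq, hpq⟩ := Finset.one_lt_card.1 (by omega : 1 < e.card)
  obtain ⟨f, -, hf, -, -⟩ := exists_represents_both hn hδ he he hpq hp hq hp hq
  refine ⟨f, hf.1, fun g hg hg3 => ?_⟩
  have hgc := (mem_tightComponent.1 hg).1
  have key := tightComponent_subset_of_closed
    (X := fun g => g.card = 3 ∧ ∃ f', Represents c δ φ i g f' ∧ TightConn 2 (colorClass c i) f f')
    ⟨h3, f, hf, .refl⟩ (fun g g' hg hgg => ?_) g hg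
  · obtain ⟨hg', f', hf', hff⟩ := key
    exact mem_tightComponent.2 ⟨image_mem_colorClass hgc hg3,
      hff.trans (hf'.tightConn hδ hg' ⟨image_mem_colorClass hgc hg3, Or.inl rfl⟩)⟩
  · obtain ⟨hgH, hgH', S, hS, hS', hSc⟩ := tightAdj_iff.1 hgg
    obtain ⟨p, hp, q, hq, hpq⟩ := Finset.one_lt_card.1 (by omega : 1 < S.card)
    obtain ⟨f₁, f₂, h1, h2, h12⟩ := exists_represents_both hn hδ hgH hgH' hpq (hS hp) (hS hq)
      (hS' hp) (hS' hq)
    obtain ⟨hg3, f', hf', hff⟩ := hg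
    exact ⟨card_of_mem_colorClass hgH', f₂, h2,
      (hff.trans (hf'.tightConn hδ hg3 h1)).trans h12⟩

theorem card_filter_image_eq_le {q : ℕ} (hq : ∀ u, (Finset.univ.filter fun x => φ x = u).card ≤ q)
    (hf : f.card = 3) :
    ((Finset.univ : Finset (Finset (Fin N))).filter
      fun e => e.card = 3 ∧ e.image φ = f).card ≤ q ^ 3 := by
  obtain ⟨a, b, d, hab, had, hbd, rfl⟩ := Finset.card_eq_three.1 hf
  let F := fun u => (Finset.univ.filter fun x => φ x = u)
  calc _ ≤ ((F a ×ˢ F b ×ˢ F d).image fun t => ({t.1, t.2.1, t.2.2} : Finset (Fin N))).card := by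
        refine Finset.card_le_card fun e he => ?_
        simp only [Finset.mem_filter, Finset.mem_univ, true_and] at he
        obtain ⟨h3, he⟩ := he
        have ha : a ∈ e.image φ := by rw [he]; simp
        have hb : b ∈ e.image φ := by rw [he]; simp
        have hd : d ∈ e.image φ := by rw [he]; simp
        obtain ⟨x, hx, rfl⟩ := Finset.mem_image.1 ha
        obtain ⟨y, hy, rfl⟩ := Finset.mem_image.1 hb
        obtain ⟨z, hz, rfl⟩ := Finset.mem_image.1 hd
        refine Finset.mem_image.2 ⟨(x, y, z), by simp [F], ?_⟩
        refine Finset.eq_of_subset_of_card_le ?_ ?_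
        · simp [Finset.insert_subset_iff, hx, hy, hz]
        · rw [h3, Finset.card_eq_three.2 ⟨x, y, z, fun h => hab (by rw [h]),
            fun h => had (by rw [h]), fun h => hbd (by rw [h]), rfl⟩]
    _ ≤ (F a ×ˢ F b ×ˢ F d).card := Finset.card_image_le
    _ ≤ q * (q * q) := by
        rw [Finset.card_product, Finset.card_product]
        exact Nat.mul_le_mul (hq a) (Nat.mul_le_mul (hq b) (hq d))
    _ = q ^ 3 := by ring

/-- Such a triple arises from a vertex, another in its fibre and an arbitrary third one. -/
theorem card_filter_doubled_le {q : ℕ}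
    (hq : ∀ u, (Finset.univ.filter fun x => φ x = u).card ≤ q) :
    ((Finset.univ : Finset (Finset (Fin N))).filter
      fun e => e.card = 3 ∧ (e.image φ).card ≠ 3).card ≤ N ^ 2 * q := by
  let T : Finset ((Σ _ : Fin N, Fin N) × Fin N) :=
    (Finset.univ.sigma fun x => Finset.univ.filter fun y => φ y = φ x) ×ˢ Finset.univ
  calc _ ≤ (T.image fun t => ({t.1.1, t.1.2, t.2} : Finset (Fin N))).card := by
        refine Finset.card_le_card fun e he => ?_
        simp only [Finset.mem_filter, Finset.mem_univ, true_and] at he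
        obtain ⟨h3, he⟩ := he
        have : ∃ u, Doubled φ e u := by
          by_contra h
          exact he (card_image_of_not_doubled h3 h)
        obtain ⟨u, x, hx, y, hy, hxy, rfl, h1⟩ := this
        obtain ⟨z, hz, hzn⟩ := Finset.exists_mem_notMem_of_card_lt_card
          (s := {x, y}) (t := e) (by rw [Finset.card_pair hxy, h3]; omega)
        simp only [Finset.mem_insert, Finset.mem_singleton, not_or] at hzn
        refine Finset.mem_image.2 ⟨(⟨x, y⟩, z), by simp [T, h1], ?_⟩
        refine Finset.eq_of_subset_of_card_le ?_ ?_
        · simp [Finset.insert_subset_iff, hx, hy, hz]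
        · rw [h3, Finset.card_eq_three.2 ⟨x, y, z, hxy, Ne.symm hzn.1, Ne.symm hzn.2, rfl⟩]
    _ ≤ T.card := Finset.card_image_le
    _ ≤ (N * q) * N := by
        rw [Finset.card_product, Finset.card_sigma, Finset.card_univ, Fintype.card_fin]
        refine Nat.mul_le_mul_right _ ((Finset.sum_le_card_nsmul _ _ q fun x _ => hq _).trans ?_)
        simp
    _ = N ^ 2 * q := by ring

theorem maxShadow_blowUp_le (hn : 3 ≤ n) (hδ : ∀ v, Dominates c (δ v) v) {q : ℕ}
    (hq : ∀ u, (Finset.univ.filter fun x => φ x = u).card ≤ q) :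
    maxShadow 2 3 (blowUp c δ φ) ≤ maxShadow 2 3 c * q ^ 3 + N ^ 2 * q := by
  classical
  refine maxShadow_self_le fun i e he => ?_
  obtain ⟨f, hf, h⟩ := exists_tightConn_of_mem_tightComponent hn hδ he
  rw [← Finset.card_filter_add_card_filter_not (fun g => (g.image φ).card = 3)]
  refine Nat.add_le_add ?_ ((Finset.card_le_card fun g hg => ?_).trans
    (card_filter_doubled_le hq))
  · calc _ ≤ ((tightComponent 2 (colorClass c i) f).biUnion fun f =>
          (Finset.univ : Finset (Finset (Fin N))).filter
            fun e => e.card = 3 ∧ e.image φ = f).card := by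
          refine Finset.card_le_card fun g hg => ?_
          obtain ⟨hg, hg3⟩ := Finset.mem_filter.1 hg
          refine Finset.mem_biUnion.2 ⟨_, h g hg (by convert hg3), ?_⟩
          simpa using card_of_mem_colorClass (mem_tightComponent.1 hg).1
      _ ≤ (tightComponent 2 (colorClass c i) f).card * q ^ 3 :=
          Finset.card_biUnion_le_card_mul _ _ _ fun f hf => card_filter_image_eq_le hq
            (card_of_mem_colorClass (mem_tightComponent.1 hf).1)
      _ ≤ _ := Nat.mul_le_mul_right _ (card_tightComponent_le c hf)
  · obtain ⟨hg, hg3⟩ := Finset.mem_filter.1 hg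
    simp only [Finset.mem_filter, Finset.mem_univ, true_and]
    exact ⟨card_of_mem_colorClass (mem_tightComponent.1 hg).1, by convert hg3⟩

theorem M_two_three_le_blowUp (hn : 3 ≤ n) (N : ℕ) :
    M N 2 3 2 3 ≤ M n 2 3 2 3 * (N / n + 1) ^ 3 + N ^ 2 * (N / n + 1) := by
  obtain ⟨c, hc⟩ := exists_maxShadow_eq n 3 2 3
  obtain ⟨δ, hδ⟩ := exists_dominates_fun hn c
  rw [← hc]
  refine (M_le (blowUp c δ fun x : Fin N => ⟨x.1 % n, Nat.mod_lt _ (by omega)⟩)).trans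
    (maxShadow_blowUp_le hn hδ fun u => ?_)
  rw [← Finset.card_range (N / n + 1)]
  -- The fibres are residue classes modulo `n`, on which the quotient is injective.
  refine Finset.card_le_card_of_injOn (fun x => x.1 / n) ?_ ?_
  · intro x _
    simp only [Finset.coe_range, Set.mem_Iio]
    exact Nat.lt_succ_of_le (Nat.div_le_div_right x.2.le)
  · intro x hx y hy hxy
    simp only [Finset.coe_filter, Finset.mem_univ, true_and, Set.mem_ofPred_eq] at hx hy
    have h := congrArg Fin.val (hx.trans hy.symm)
    simp only at h hxy
    ext
    rw [← Nat.div_add_mod x.1 n, ← Nat.div_add_mod y.1 n, h, hxy]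

end BlowUp

/-! ### Existence of the limit for `t = 2`, `s = 3` -/

section Limit

open Filter Topology

/-- A sequence that is, up to errors tending to `0`, eventually bounded by each of its terms,
converges if it is bounded below. -/
theorem exists_tendsto_of_eventually_le_add {a b : ℕ → ℝ} (h0 : ∀ n, 0 ≤ a n)
    (hb : Tendsto b atTop (𝓝 0)) (hb0 : ∀ n, 0 ≤ b n)
    (h : ∀ᶠ n in atTop, ∀ ε > 0, ∀ᶠ N in atTop, a N ≤ a n + b n + ε) :
    ∃ l, Tendsto a atTop (𝓝 l) := by
  obtain ⟨k, hk⟩ := eventually_atTop.1 h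
  set S := (fun n => a n + b n) '' Set.Ici k
  have hS : BddBelow S := ⟨0, by
    rintro _ ⟨n, _, rfl⟩
    exact add_nonneg (h0 n) (hb0 n)⟩
  have hne : S.Nonempty := ⟨_, k, Set.self_mem_Ici, rfl⟩
  refine ⟨sInf S, Metric.tendsto_atTop.2 ?_⟩
  intro ε hε
  obtain ⟨_, ⟨n, hn, rfl⟩, hlt⟩ := exists_lt_of_csInf_lt hne (lt_add_of_pos_right (sInf S)
    (half_pos hε))
  have hb' := hb.eventually_lt_const hε
  obtain ⟨m, hm⟩ := eventually_atTop.1 (((hk n hn _ (half_pos hε)).and hb').and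
    (eventually_ge_atTop k))
  refine ⟨m, fun N hN => ?_⟩
  obtain ⟨⟨h1, h2⟩, h3⟩ := hm N hN
  have h4 : sInf S ≤ a N + b N := csInf_le hS ⟨N, h3, rfl⟩
  simp only at hlt
  rw [Real.dist_eq, abs_lt]
  constructor <;> linarith

theorem exists_tendsto_M_two_three :
    ∃ l, Tendsto (fun n : ℕ => ((n.choose 3 : ℕ) : ℝ)⁻¹ * (M n 2 3 2 3 : ℝ)) atTop (𝓝 l) := by
  -- The error `6 / n` is the limiting density of the bound `N ^ 2 * (N / n + 1)` on doubled
  -- triples.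
  refine exists_tendsto_of_eventually_le_add (b := fun n => 6 / n) (fun n => by positivity)
    (tendsto_const_div_atTop_nhds_zero_nat 6) (fun n => by positivity) ?_
  filter_upwards [eventually_ge_atTop 3] with n hn ε hε
  have h0 : Tendsto (fun n : ℕ => (n : ℝ)⁻¹) atTop (𝓝 0) := tendsto_inv_atTop_nhds_zero_nat
  have h1 : Tendsto (fun N : ℕ => (N : ℝ) ^ 3 / N.choose 3 *
      ((M n 2 3 2 3 : ℝ) * ((n : ℝ)⁻¹ + (N : ℝ)⁻¹) ^ 3 + ((n : ℝ)⁻¹ + (N : ℝ)⁻¹))) atTop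
      (𝓝 (6 * ((M n 2 3 2 3 : ℝ) * ((n : ℝ)⁻¹ + 0) ^ 3 + ((n : ℝ)⁻¹ + 0)))) :=
    tendsto_cube_div_choose_three.mul
      ((tendsto_const_nhds.mul ((tendsto_const_nhds.add h0).pow 3)).add
        (tendsto_const_nhds.add h0))
  have hn0 : (0 : ℝ) < n := by positivity
  have h2 : 6 * ((M n 2 3 2 3 : ℝ) * ((n : ℝ)⁻¹ + 0) ^ 3 + ((n : ℝ)⁻¹ + 0)) <
      ((n.choose 3 : ℕ) : ℝ)⁻¹ * (M n 2 3 2 3 : ℝ) + 6 / n + ε := by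
    have hc : (0 : ℝ) < n.choose 3 := by exact_mod_cast Nat.choose_pos hn
    have h3 : 6 * ((n : ℝ)⁻¹) ^ 3 ≤ ((n.choose 3 : ℕ) : ℝ)⁻¹ := by
      have := inv_anti₀ hc (choose_three_le n)
      rw [inv_div] at this
      rwa [inv_pow, ← div_eq_mul_inv]
    have h4 := mul_le_mul_of_nonneg_right h3 (Nat.cast_nonneg (M n 2 3 2 3) : (0 : ℝ) ≤ _)
    rw [div_eq_mul_inv, add_zero]
    linarith
  filter_upwards [h1.eventually_lt_const h2, eventually_ge_atTop 3] with N hN hN3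
  refine le_trans ?_ hN.le
  have hN0 : (0 : ℝ) < N := by positivity
  have h5 : (M N 2 3 2 3 : ℝ) ≤ M n 2 3 2 3 * ((N / n : ℕ) + 1) ^ 3 +
      (N : ℝ) ^ 2 * ((N / n : ℕ) + 1) := by
    exact_mod_cast M_two_three_le_blowUp hn N
  have h6 : ((N / n : ℕ) : ℝ) + 1 ≤ N * ((n : ℝ)⁻¹ + (N : ℝ)⁻¹) := by
    rw [mul_add, mul_inv_cancel₀ hN0.ne', ← div_eq_mul_inv]
    exact add_le_add_left Nat.cast_div_le _
  have h7 : (M N 2 3 2 3 : ℝ) ≤ M n 2 3 2 3 * (N * ((n : ℝ)⁻¹ + (N : ℝ)⁻¹)) ^ 3 +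
      (N : ℝ) ^ 2 * (N * ((n : ℝ)⁻¹ + (N : ℝ)⁻¹)) := by
    refine h5.trans ?_
    gcongr
  rw [div_eq_inv_mul, mul_assoc]
  refine mul_le_mul_of_nonneg_left (h7.trans (le_of_eq ?_)) (by positivity)
  ring

end Limit

/-! ### The upper bound `3 / 8` -/

section TwoTightUpper

variable {n : ℕ}

theorem card_inter_le_of_tightAdj {H : Finset (Finset (Fin n))} (hH : ∀ e ∈ H, e.card = 3)
    {e f : Finset (Fin n)} (A : Finset (Fin n)) (h : TightAdj 2 H e f) :
    (e ∩ A).card ≤ (f ∩ A).card + 1 := by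
  obtain ⟨he, -, S, hSe, hSf, hS⟩ := tightAdj_iff.1 h
  have h1 : e ∩ A ⊆ (f ∩ A) ∪ (e \ S) := by
    intro x hx
    rw [Finset.mem_inter] at hx
    by_cases hxS : x ∈ S
    · exact Finset.mem_union_left _ (Finset.mem_inter.2 ⟨hSf hxS, hx.2⟩)
    · exact Finset.mem_union_right _ (Finset.mem_sdiff.2 ⟨hx.1, hxS⟩)
  have h2 := (Finset.card_le_card h1).trans (Finset.card_union_le _ _)
  have h3 := Finset.card_sdiff_of_subset hSe
  have h4 := hH e he
  omega

/-- Under the parity coloring, adjacent edges of one color meet `A` in numbers of equal parity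
differing by at most one, hence equal. Each component thus has a fixed intersection size with `A`;
the largest count is `m * m.choose 2`. -/
theorem M_two_three_double_le (m : ℕ) : (M (2 * m) 2 3 2 3 : ℝ) ≤ (m : ℝ) ^ 3 / 2 := by
  obtain ⟨A, -, hA⟩ := Finset.exists_subset_card_eq
    (by simp; omega : m ≤ (Finset.univ : Finset (Fin (2 * m))).card)
  have hcol : ∀ i, ∀ e ∈ colorClass (coloringOf 3 fun e => Odd (e ∩ A).card) i,
      ∀ f ∈ colorClass (coloringOf 3 fun e => Odd (e ∩ A).card) i,
      (Odd (e ∩ A).card ↔ Odd (f ∩ A).card) := by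
    intro i e he f hf
    obtain rfl | rfl : i = 0 ∨ i = 1 := by omega
    · exact iff_of_true (mem_colorClass_zero.1 he).2 (mem_colorClass_zero.1 hf).2
    · exact iff_of_false (mem_colorClass_one.1 he).2 (mem_colorClass_one.1 hf).2
  have h : M (2 * m) 2 3 2 3 ≤ max (m * m.choose 2) (m.choose 3) := by
    refine (M_le (coloringOf 3 fun e => Odd (e ∩ A).card)).trans
      (maxShadow_self_le fun i e he => ?_)
    have hle : (tightComponent 2 (colorClass (coloringOf 3 fun e => Odd (e ∩ A).card) i) e).card ≤
        m.choose (e ∩ A).card * m.choose (3 - (e ∩ A).card) := by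
      have h1 := card_filter_inter_le A (e ∩ A).card 3
      have h2 : 2 * m - A.card = m := by omega
      rw [h2, hA] at h1
      refine (Finset.card_le_card fun f hf => ?_).trans h1
      simp only [Finset.mem_filter, Finset.mem_univ, true_and]
      refine ⟨card_of_mem_colorClass (mem_tightComponent.1 hf).1, ?_⟩
      refine tightComponent_subset_of_closed (X := fun f => (f ∩ A).card = (e ∩ A).card) rfl
        (fun f g hf hfg => ?_) f hf
      have a1 := card_inter_le_of_tightAdj (fun _ => card_of_mem_colorClass) A hfg
      have a2 := card_inter_le_of_tightAdj (fun _ => card_of_mem_colorClass) A hfg.symm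
      have a3 := hcol i f hfg.1 g hfg.2.1
      rw [← hf]
      grind
    refine hle.trans ?_
    have h3 : (e ∩ A).card ≤ 3 :=
      (Finset.card_le_card Finset.inter_subset_left).trans (card_of_mem_colorClass he).le
    interval_cases (e ∩ A).card <;> simp [mul_comm]
  have h' : (M (2 * m) 2 3 2 3 : ℝ) ≤ max (m * m.choose 2 : ℝ) (m.choose 3) := by
    exact_mod_cast h
  have hm : (0 : ℝ) ≤ m := m.cast_nonneg
  refine h'.trans (max_le ?_ ?_)
  · rw [Nat.cast_choose_two]
    nlinarith [sq_nonneg (m : ℝ)]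
  · have := choose_three_le m
    have h3 : (0 : ℝ) ≤ (m : ℝ) ^ 3 := by positivity
    linarith

end TwoTightUpper

/-! ### The lower bound `0.24` -/

section TwoTightLower

variable {n : ℕ}

theorem card_filter_mem_le_card_shadow {C : Finset (Finset (Fin n))} (hC : ∀ e ∈ C, e.card = 3)
    (z : Fin n) : (C.filter fun e => z ∈ e).card ≤ (shadow 2 C).card := by
  refine Finset.card_le_card_of_injOn (fun e => e.erase z) ?_ ?_
  · intro e he
    obtain ⟨he, hz⟩ := Finset.mem_filter.1 he
    refine mem_shadow.2 ⟨?_, e, he, Finset.erase_subset _ _⟩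
    rw [Finset.card_erase_of_mem hz, hC e he]
  · intro e he f hf h
    rw [← Finset.insert_erase (Finset.mem_filter.1 he).2,
      ← Finset.insert_erase (Finset.mem_filter.1 hf).2]
    exact congrArg (insert z) h

theorem card_filter_mem_le_choose_degree {C : Finset (Finset (Fin n))}
    (hC : ∀ e ∈ C, e.card = 3) (z : Fin n) :
    (C.filter fun e => z ∈ e).card ≤ ((shadow 2 C).filter fun p => z ∈ p).card.choose 2 := by
  have h := card_filter_mem_le_choose_two (v := z) (X := C.filter fun e => z ∈ e)
    (W := Finset.univ.filter fun x => x ≠ z ∧ ({z, x} : Finset (Fin n)) ∈ shadow 2 C) ?_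
  · refine h.trans (Nat.choose_le_choose _ ?_)
    refine Finset.card_le_card_of_injOn (fun x => {z, x}) ?_ ?_
    · intro x hx
      simp only [Finset.coe_filter, Finset.mem_univ, true_and, Set.mem_ofPred_eq] at hx
      simp [hx.2]
    · intro x hx y hy hxy
      simp only [Finset.coe_filter, Finset.mem_univ, true_and, Set.mem_ofPred_eq] at hx hy
      have : x ∈ ({z, y} : Finset (Fin n)) := by
        rw [← show ({z, x} : Finset (Fin n)) = {z, y} from hxy]
        simp
      simpa [hx.1] using this
  · intro e he
    obtain ⟨he, hz⟩ := Finset.mem_filter.1 he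
    refine ⟨hC e he, hz, fun x hx => ?_⟩
    obtain ⟨hxz, hx⟩ := Finset.mem_erase.1 hx
    refine Finset.mem_filter.2 ⟨Finset.mem_univ _, hxz, mem_shadow.2
      ⟨Finset.card_pair hxz.symm, e, he, ?_⟩⟩
    simp [Finset.insert_subset_iff, hz, hx]

/-- The Kruskal–Katona bound for triples, in its asymptotic form. -/
theorem nine_mul_sq_card_le {C : Finset (Finset (Fin n))} (hC : ∀ e ∈ C, e.card = 3) :
    9 * (C.card : ℝ) ^ 2 ≤ 2 * ((shadow 2 C).card : ℝ) ^ 3 := by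
  set E : ℝ := ((shadow 2 C).card : ℝ) with hE
  have hE0 : 0 ≤ E := Nat.cast_nonneg _
  have h1 : ∑ z : Fin n, ((C.filter fun e => z ∈ e).card : ℝ) = 3 * C.card := by
    exact_mod_cast sum_card_filter_mem hC
  have h2 : ∑ z : Fin n, (((shadow 2 C).filter fun p => z ∈ p).card : ℝ) = 2 * E := by
    rw [hE]
    exact_mod_cast sum_card_filter_mem fun p hp => (mem_shadow.1 hp).1
  -- A vertex of shadow degree `d` lies in at most `min(E, d²/2)` triples, hence in at most the
  -- geometric mean of the two, which is linear in `d` and can be summed.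
  have h3 : ∀ z ∈ (Finset.univ : Finset (Fin n)), ((C.filter fun e => z ∈ e).card : ℝ) ≤
      Real.sqrt (E / 2) * ((shadow 2 C).filter fun p => z ∈ p).card := by
    intro z _
    have a1 : ((C.filter fun e => z ∈ e).card : ℝ) ≤ E := by
      rw [hE]
      exact_mod_cast card_filter_mem_le_card_shadow hC z
    have a2 : ((C.filter fun e => z ∈ e).card : ℝ) ≤
        (((shadow 2 C).filter fun p => z ∈ p).card.choose 2 : ℝ) := by
      exact_mod_cast card_filter_mem_le_choose_degree hC z
    rw [Nat.cast_choose_two] at a2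
    set t : ℝ := ((C.filter fun e => z ∈ e).card : ℝ)
    set d : ℝ := (((shadow 2 C).filter fun p => z ∈ p).card : ℝ)
    have t0 : 0 ≤ t := Nat.cast_nonneg _
    have d0 : 0 ≤ d := Nat.cast_nonneg _
    refine abs_le_of_sq_le_sq' ?_ (by positivity) |>.2
    rw [mul_pow, Real.sq_sqrt (by positivity)]
    have a3 : t ≤ d ^ 2 / 2 := by nlinarith
    calc t ^ 2 = t * t := sq t
      _ ≤ E * (d ^ 2 / 2) := mul_le_mul a1 a3 t0 hE0
      _ = _ := by ring
  have h4 := Finset.sum_le_sum h3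
  rw [h1, ← Finset.mul_sum, h2] at h4
  have h5 := pow_le_pow_left₀ (by positivity) h4 2
  rw [mul_pow, mul_pow _ _ 2, mul_pow 2 E, Real.sq_sqrt (by positivity)] at h5
  linarith

/-- A pair in both shadows would make two edges adjacent and merge the components. -/
theorem pairwiseDisjoint_shadow_tightComponents (H : Finset (Finset (Fin n))) :
    (tightComponents 2 H : Set (Finset (Finset (Fin n)))).PairwiseDisjoint (shadow 2) := by
  intro C₁ h₁ C₂ h₂ hne
  refine Finset.disjoint_left.2 fun S hS₁ hS₂ => hne ?_
  obtain ⟨e₁, he₁, rfl⟩ := mem_tightComponents.1 (Finset.mem_coe.1 h₁)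
  obtain ⟨e₂, he₂, rfl⟩ := mem_tightComponents.1 (Finset.mem_coe.1 h₂)
  obtain ⟨hS, f₁, hf₁, hSf₁⟩ := mem_shadow.1 hS₁
  obtain ⟨-, f₂, hf₂, hSf₂⟩ := mem_shadow.1 hS₂
  rw [mem_tightComponent] at hf₁ hf₂
  have h12 : TightConn 2 H e₁ e₂ := (hf₁.2.trans (.single (tightAdj_iff.2
    ⟨hf₁.1, hf₂.1, S, hSf₁, hSf₂, hS.ge⟩))).trans hf₂.2.symm
  ext g
  rw [mem_tightComponent, mem_tightComponent]
  exact and_congr_right fun _ => ⟨h12.symm.trans, h12.trans⟩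

/-- Components have disjoint shadows, so a bound on edges per shadow pair can be summed over all of
them. -/
theorem card_le_mul_choose_two {H : Finset (Finset (Fin n))} {κ : ℝ}
    (hκ : ∀ C ∈ tightComponents 2 H, (C.card : ℝ) ≤ κ * (shadow 2 C).card) (hκ0 : 0 ≤ κ) :
    (H.card : ℝ) ≤ κ * n.choose 2 := by
  have h1 : H.card ≤ ∑ C ∈ tightComponents 2 H, C.card := by
    refine (Finset.card_le_card fun e he => ?_).trans (Finset.card_biUnion_le (t := id))
    exact Finset.mem_biUnion.2 ⟨_, mem_tightComponents.2 ⟨e, he, rfl⟩,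
      mem_tightComponent.2 ⟨he, .refl⟩⟩
  have h2 : ∑ C ∈ tightComponents 2 H, (shadow 2 C).card ≤ n.choose 2 := by
    rw [← Finset.card_biUnion (pairwiseDisjoint_shadow_tightComponents H)]
    refine (Finset.card_le_card (t := Finset.powersetCard 2 Finset.univ) fun S hS => ?_).trans ?_
    · obtain ⟨C, -, hS⟩ := Finset.mem_biUnion.1 hS
      simpa [Finset.mem_powersetCard] using (mem_shadow.1 hS).1
    · simp
  calc (H.card : ℝ) ≤ ∑ C ∈ tightComponents 2 H, (C.card : ℝ) := by exact_mod_cast h1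
    _ ≤ ∑ C ∈ tightComponents 2 H, κ * (shadow 2 C).card := Finset.sum_le_sum hκ
    _ = κ * (∑ C ∈ tightComponents 2 H, (shadow 2 C).card : ℕ) := by
        rw [← Finset.mul_sum, Nat.cast_sum]
    _ ≤ κ * n.choose 2 := mul_le_mul_of_nonneg_left (by exact_mod_cast h2) hκ0

theorem card_filter_dominated_le {c : Coloring n 2 3} {δ : Fin n → Fin 2}
    (hδ : ∀ v, Dominates c (δ v) v) (i : Fin 2) :
    ((colorClass c i).filter fun e => ∃ v ∈ e, δ v = i).card ≤ maxShadow 2 3 c := by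
  refine card_le_maxShadow c (Finset.filter_subset _ _) fun e he f hf => ?_
  obtain ⟨he, u, hu, rfl⟩ := Finset.mem_filter.1 he
  obtain ⟨hf, v, hv, hvi⟩ := Finset.mem_filter.1 hf
  exact (hδ u).tightConn (hvi ▸ hδ v) he hf hu hv

theorem card_colorClass_le_filter_add (c : Coloring n 2 3) (δ : Fin n → Fin 2) {i j : Fin 2} (hij : i ≠ j) :
    (colorClass c i).card ≤ ((colorClass c i).filter fun e => ∃ v ∈ e, δ v = i).card +
      (Finset.univ.filter fun v => δ v = j).card.choose 3 := by
  rw [← Finset.card_powersetCard]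
  refine (Finset.card_le_card fun e he => ?_).trans (Finset.card_union_le _ _)
  rw [Finset.mem_union, Finset.mem_filter, Finset.mem_powersetCard]
  by_cases h : ∃ v ∈ e, δ v = i
  · exact Or.inl ⟨he, h⟩
  · push Not at h
    refine Or.inr ⟨fun v hv => ?_, card_of_mem_colorClass he⟩
    have := h v hv
    simp only [Finset.mem_filter, Finset.mem_univ, true_and]
    omega

/-- If all components were below `0.04 n ^ 3`, color `i` would have at most that many dominated
edges plus the triples of the small class `j`, and color `j` about `0.105 n ^ 3` by Kruskal–Katona.
Together this is less than `n ^ 3 / 6`. -/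
theorem le_maxShadow_of_unbalanced {c : Coloring n 2 3} {δ : Fin n → Fin 2}
    (hδ : ∀ v, Dominates c (δ v) v) {i j : Fin 2} (hij : i ≠ j)
    (hj : ((Finset.univ.filter fun v => δ v = j).card : ℝ) ≤ n / 5) :
    24 / 100 * (n : ℝ) ^ 3 / 6 - (n : ℝ) ^ 2 ≤ maxShadow 2 3 c := by
  have hn0 : (0 : ℝ) ≤ n := n.cast_nonneg
  by_contra! hD
  have h1 : ((colorClass c i).card : ℝ) ≤ maxShadow 2 3 c +
      (Finset.univ.filter fun v => δ v = j).card.choose 3 := by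
    exact_mod_cast (card_colorClass_le_filter_add c δ hij).trans
      (Nat.add_le_add_right (card_filter_dominated_le hδ i) _)
  have h2 := choose_three_le (Finset.univ.filter fun v => δ v = j).card
  have h3 := pow_le_pow_left₀ (Nat.cast_nonneg _) hj 3
  have hN : ((colorClass c i).card : ℝ) + (colorClass c j).card = n.choose 3 := by
    exact_mod_cast card_colorClass_add c hij
  have hNle := le_choose_three n
  -- Kruskal–Katona with `T ≤ 0.04 n ^ 3` gives `T ^ 3 ≤ (0.08 / 9) (nE) ^ 3`, and `0.08 / 9 < 0.21
  -- ^ 3`.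
  have h4 : ((colorClass c j).card : ℝ) ≤ 21 / 100 * n * n.choose 2 := by
    refine card_le_mul_choose_two (fun C hC => ?_) (by positivity)
    obtain ⟨e, he, rfl⟩ := mem_tightComponents.1 hC
    have a1 := nine_mul_sq_card_le (C := tightComponent 2 (colorClass c j) e)
      fun f hf => card_of_mem_colorClass (mem_tightComponent.1 hf).1
    have a2 : ((tightComponent 2 (colorClass c j) e).card : ℝ) ≤ maxShadow 2 3 c := by
      exact_mod_cast card_tightComponent_le c he
    set T : ℝ := ((tightComponent 2 (colorClass c j) e).card : ℝ)
    set E : ℝ := ((shadow 2 (tightComponent 2 (colorClass c j) e)).card : ℝ)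
    have T0 : 0 ≤ T := Nat.cast_nonneg _
    have E0 : 0 ≤ E := Nat.cast_nonneg _
    refine le_of_pow_le_pow_left₀ (n := 3) (by norm_num) (by positivity) ?_
    have a3 : T ≤ 4 / 100 * (n : ℝ) ^ 3 := by nlinarith [sq_nonneg (n : ℝ)]
    have a4 : 9 * T ^ 3 ≤ 2 * E ^ 3 * T := by
      calc 9 * T ^ 3 = 9 * T ^ 2 * T := by ring
        _ ≤ _ := mul_le_mul_of_nonneg_right a1 T0
    have a5 : 2 * E ^ 3 * T ≤ 2 * E ^ 3 * (4 / 100 * (n : ℝ) ^ 3) :=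
      mul_le_mul_of_nonneg_left a3 (by positivity)
    have a6 : (21 / 100 * n * E) ^ 3 = 9261 / 1000000 * (E ^ 3 * (n : ℝ) ^ 3) := by ring
    have a7 : 0 ≤ E ^ 3 * (n : ℝ) ^ 3 := by positivity
    rw [a6]
    linarith
  rw [Nat.cast_choose_two] at h4
  nlinarith [sq_nonneg (n : ℝ), (by positivity : (0 : ℝ) ≤ (n : ℝ) ^ 3)]

theorem le_maxShadow_two_three (hn : 3 ≤ n) (c : Coloring n 2 3) :
    24 / 100 * (n : ℝ) ^ 3 / 6 - (n : ℝ) ^ 2 ≤ maxShadow 2 3 c := by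
  obtain ⟨δ, hδ⟩ := exists_dominates_fun hn c
  by_cases h0 : ((Finset.univ.filter fun v => δ v = 0).card : ℝ) ≤ n / 5
  · exact le_maxShadow_of_unbalanced hδ (by decide : (1 : Fin 2) ≠ 0) h0
  by_cases h1 : ((Finset.univ.filter fun v => δ v = 1).card : ℝ) ≤ n / 5
  · exact le_maxShadow_of_unbalanced hδ (by decide : (0 : Fin 2) ≠ 1) h1
  push Not at h0 h1
  have hab := card_filter_color_add δ
  have b0 : ((colorClass c 0).card : ℝ) ≤ maxShadow 2 3 c +
      (Finset.univ.filter fun v => δ v = 1).card.choose 3 := by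
    exact_mod_cast (card_colorClass_le_filter_add c δ (by decide)).trans
      (Nat.add_le_add_right (card_filter_dominated_le hδ 0) _)
  have b1 : ((colorClass c 1).card : ℝ) ≤ maxShadow 2 3 c +
      (Finset.univ.filter fun v => δ v = 0).card.choose 3 := by
    exact_mod_cast (card_colorClass_le_filter_add c δ (by decide)).trans
      (Nat.add_le_add_right (card_filter_dominated_le hδ 1) _)
  have hN : ((colorClass c 0).card : ℝ) + (colorClass c 1).card = n.choose 3 := by
    exact_mod_cast card_colorClass_add c (by decide)
  set a := (Finset.univ.filter fun v => δ v = 0).card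
  set b := (Finset.univ.filter fun v => δ v = 1).card
  have hn' : (3 : ℝ) ≤ n := by exact_mod_cast hn
  have hb : b = n - a := by omega
  have habr : (a : ℝ) + b = n := by exact_mod_cast hab
  have h3 := choose_three_sub_sub (n := n) (w := a) (by omega)
  rw [← hb] at h3
  -- Both classes exceed `n / 5`, so `a(n - a)` is at least `(1/5)(4/5) n ^ 2`. The dominated
  -- components of the two colors together contain all triples that meet both classes, up to
  -- counting.
  have h4 : 4 / 25 * (n : ℝ) ^ 2 ≤ a * (n - a) := by nlinarith
  have h5 : 4 / 25 * (n : ℝ) ^ 2 * (n - 2) ≤ a * (n - a) * (n - 2) :=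
    mul_le_mul_of_nonneg_right h4 (by linarith)
  nlinarith [sq_nonneg (n : ℝ)]

end TwoTightLower

end TightColoring

/-! ### The main theorem -/

open TightColoring in
theorem corollary5 :
    (∀ n : ℕ, 3 ≤ n →
      TightColoring.M n 2 3 1 1 = n ∧
      (TightColoring.M n 2 3 1 2 : ℤ) = (n.choose 2 : ℤ) - ((n / 2).choose 2 : ℤ) ∧
      TightColoring.M n 2 3 2 1 = n ∧
      (TightColoring.M n 2 3 2 2 : ℤ) = (n.choose 2 : ℤ) - ((n / 2).choose 2 : ℤ)) ∧
    Filter.Tendsto (fun n : ℕ => ((n.choose 3 : ℕ) : ℝ)⁻¹ * (TightColoring.M n 2 3 1 3 : ℝ))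
      Filter.atTop (nhds (6 * Real.sqrt 21 - 27)) ∧
    |6 * Real.sqrt 21 - 27 - 0.495| < 0.0005 ∧
    ∃ Λ : ℝ,
      Filter.Tendsto (fun n : ℕ => ((n.choose 3 : ℕ) : ℝ)⁻¹ * (TightColoring.M n 2 3 2 3 : ℝ))
        Filter.atTop (nhds Λ) ∧
      0.24 ≤ Λ ∧ Λ ≤ 3 / 8 := by
  refine ⟨fun n hn => ⟨M_shadow_one hn (by norm_num), M_shadow_two hn le_rfl (by norm_num),
    M_shadow_one hn le_rfl, M_shadow_two hn (by norm_num) le_rfl⟩, tendsto_M_one_three, ?_, ?_⟩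
  · have h1 : 4.58257 < Real.sqrt 21 := Real.lt_sqrt_of_sq_lt (by norm_num)
    have h2 : Real.sqrt 21 < 4.58258 := (Real.sqrt_lt' (by norm_num)).2 (by norm_num)
    rw [abs_lt]
    constructor <;> norm_num at * <;> linarith
  · obtain ⟨l, hl⟩ := exists_tendsto_M_two_three
    refine ⟨l, hl, ?_, ?_⟩
    · have h := tendsto_density (24 / 100) (-1)
      have : (0.24 : ℝ) = 24 / 100 := by norm_num
      rw [this]
      refine le_of_tendsto_of_tendsto h hl ?_
      filter_upwards [Filter.eventually_ge_atTop 3] with n hn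
      refine mul_le_mul_of_nonneg_left ?_ (by positivity)
      obtain ⟨c, hc⟩ := exists_maxShadow_eq n 3 2 3
      have := le_maxShadow_two_three hn c
      rw [← hc]
      linarith
    -- As the limit is known to exist, even orders suffice for the upper bound.
    · have h2 : Filter.Tendsto (fun m : ℕ => 2 * m) Filter.atTop Filter.atTop :=
        Filter.tendsto_id.const_mul_atTop' (by norm_num)
      refine le_of_tendsto_of_tendsto' (hl.comp h2) ((tendsto_density (3 / 8) 0).comp h2)
        fun m => ?_
      refine mul_le_mul_of_nonneg_left ((M_two_three_double_le m).trans (le_of_eq ?_))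
        (by positivity)
      push_cast
      ring
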